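/- Let $X=\bigoplus_{i\in\frac12\mathbb Z}X^i$ be a finite-dimensional real graded conformal symplectic space: it carries a symplectic form $\sigma$ (fixed up to a nonzero factor) with $\sigma(X^i,X^j)=0$ for $i+j\ne0$. Put $X_i=\bigoplus_{k\ge i}X^k$ and $\mathfrak{csp}^k(X)=\{A\in\mathfrak{csp}(X): A(X^i)\subset X^{i+k}\ \forall i\}$. Let $\delta_{\rm mod}\subset\mathfrak{csp}^{-1}(X)$ be a line which, up to a grading-preserving conformal symplectic isomorphism, is the direct sum of finitely many indecomposable symbols $\mathbb R\delta_{s,l}$ (with integers $0\le l\le 2s$) and of at most one symbol $\mathbb R\tau_m$ (with $m>0$, $m\in\frac12+\mathbb Z$); modified Jacobi symbols of distributions to which the conditions below apply are of this kind. Here $\delta_{s,l}$ acts on the space with basis $e_s,\dots,e_{s-l},f_{l-s},\dots,f_{-s}$ (indices are weights) by $e_i\mapsto e_{i-1}$, $f_i\mapsto f_{i-1}$ (with $e_{s-l},f_{-s}\mapsto0$), where $\sigma(e_i,f_{-i})=(-1)^{s-i}$ and all other products (up to skew symmetry) are $0$; and $\tau_m$ acts on the space with basis $\varepsilon_m,\dots,\varepsilon_{-m}$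 by $\varepsilon_i\mapsto\varepsilon_{i-1}$, $\varepsilon_{-m}\mapsto0$, where $\sigma(\varepsilon_i,\varepsilon_{-i})=(-1)^{m-i}$ and all other products are $0$. The skew Young diagram of $\delta_{\rm mod}$ has the rows $(e_s,\dots,e_{s-l})$ and $(f_{l-s},\dots,f_{-s})$ for each component $\delta_{s,l}$ and the row $(\varepsilon_m,\dots,\varepsilon_{-m})$ for the component $\tau_m$; boxes of equal weight lie in the same column, and weights decrease from left to right. Assume that 1. the diagram does not contain two rows such that the leftmost box of one of them lies in the same column as, or to the right of, the rightmost box of the other; 2. the diagram does not consist of one row with two boxes; 3. every row with integer weights has at least $4$ boxes; 4. the row with weights in $\frac12+\mathbb Z$ (if it exists) has at least $6$ boxes. Let $\mathfrak u^F(\delta_{\rm mod})=\bigoplus_{k\in\frac12\mathbb Z,\,k\ge-1}\mathfrak u^F_k$ be the universal algebraic prolongation of $\delta_{\rm mod}$ in $\mathfrak{csp}(X)$, where $\mathfrak u^F_{-1}=\delta_{\rm mod}$, $\mathfrak u^F_{-1/2}=0$ and $\mathfrak u^F_k=\{A\in\mathfrak{csp}^k(X):[A,\delta_{\rm mod}]\subset\mathfrak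 u^F_{k-1}\}$ for $k\ge0$. Let $\eta=\eta^{-1}\oplus\eta^{-2}$, $\eta^{-1}=X$, $\eta^{-2}=\mathbb R$, be the Heisenberg algebra with $[v,w]=\sigma(v,w)\in\eta^{-2}$ for $v,w\in X$. Let $\mathfrak u^i(\eta,\mathfrak u^F(\delta_{\rm mod}))$ be the Tanaka prolongations: $\mathfrak u^{-2}=\eta^{-2}$, $\mathfrak u^{-1}=\eta^{-1}$, $\mathfrak u^0=\mathfrak u^F(\delta_{\rm mod})$ (acting on $\eta$ by derivations of degree $0$), and for $i>0$ $$\mathfrak u^i=\{f\in\operatorname{Hom}(\eta^{-1},\mathfrak u^{i-1})\oplus\operatorname{Hom}(\eta^{-2},\mathfrak u^{i-2}): f([v,w])=[f(v),w]+[v,f(w)]\ \ \forall v,w\in\eta\},$$ where $[f,v]=-[v,f]=f(v)$ for $f$ of nonnegative degree and $v\in\eta$. Let $\mathfrak l(X)$ be the algebra of all $A\in\mathfrak{sp}(X)$ with $A(e^xX_i)\subset e^xX_i$ for all $x\in\delta_{\rm mod}$ and all $i$, i.e. the algebra of infinitesimal symmetries of the flat curve $x\mapsto\{e^xX_i\}_i$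 with symbol $\delta_{\rm mod}$ considered as a parametrized curve. For $i>0$ let $\mathfrak l(X)^{(i)}$ be its standard $i$-th prolongation: the space of all symmetric multilinear maps $X^{i+1}\to X$ which become elements of $\mathfrak l(X)$ when all but one argument are fixed. Then for every $i>0$ the Tanaka prolongation $\mathfrak u^i(\eta,\mathfrak u^F(\delta_{\rm mod}))$ coincides with $\mathfrak l(X)^{(i)}$: the restriction of its elements to $X=\eta^{-1}$, which sends $f$ to $(v_0,\dots,v_i)\mapsto f(v_0)(v_1)\cdots(v_i)$, is injective on $\mathfrak u^i(\eta,\mathfrak u^F(\delta_{\rm mod}))$ and has image $\mathfrak l(X)^{(i)}$. -/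

import Mathlib

open Module

universe u

attribute [local instance] LieRing.ofAssociativeRing

/-! ## Graded conformal symplectic spaces and symplectic flag symbols

All weights and degrees lie in `½ℤ`. They are written through their doubles: the integer `j` stands
for the weight (or degree) `j / 2`. -/

/-- A graded conformal symplectic space: a real vector space with a `½ℤ`-grading and a symplectic
form (a representative of the conformal class) for which the components of weights `i` and `j` are
skew-orthogonal unless `i + j = 0`. The component of weight `j / 2` is `grading j`. -/
structure GradedSympSpace (X : Type u) [AddCommGroup X] [Module ℝ X] where
  /-- a symplectic form representing the conformal symplectic structure -/
  form : LinearMap.BilinForm ℝ X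
  isAlt : form.IsAlt
  nondegenerate : form.Nondegenerate
  /-- the graded components (double index) -/
  grading : ℤ → Submodule ℝ X
  isInternal : DirectSum.IsInternal grading
  form_eq_zero : ∀ i j : ℤ, i + j ≠ 0 → ∀ x ∈ grading i, ∀ y ∈ grading j, form x y = 0

namespace GradedSympSpace

variable {X : Type u} [AddCommGroup X] [Module ℝ X] (G : GradedSympSpace X)

/-- The decreasing filtration `X_i = ⨁_{k ≥ i} X^k`. -/
def filtration (i : ℤ) : Submodule ℝ X := ⨆ k : ℤ, ⨆ _ : i ≤ k, G.grading k

/-- `csp^j(X)`: the endomorphisms of degree `j / 2` in the conformal symplectic algebra. -/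
def csp (j : ℤ) : Submodule ℝ (Module.End ℝ X) where
  carrier := {A | (∃ c : ℝ, ∀ x y, G.form (A x) y + G.form x (A y) = c * G.form x y) ∧
    ∀ i : ℤ, ∀ x ∈ G.grading i, A x ∈ G.grading (i + j)}
  zero_mem' := ⟨⟨0, by simp⟩, by simp⟩
  add_mem' := by
    rintro A B ⟨⟨c, hc⟩, hA⟩ ⟨⟨d, hd⟩, hB⟩
    refine ⟨⟨c + d, fun x y => ?_⟩, fun i x hx => add_mem (hA i x hx) (hB i x hx)⟩
    simp only [LinearMap.add_apply, map_add]
    linear_combination hc x y + hd x y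
  smul_mem' := by
    rintro a A ⟨⟨c, hc⟩, hA⟩
    refine ⟨⟨a * c, fun x y => ?_⟩, fun i x hx => Submodule.smul_mem _ a (hA i x hx)⟩
    simp only [LinearMap.smul_apply, map_smul, smul_eq_mul]
    linear_combination a * hc x y

end GradedSympSpace

/-- A symplectic flag symbol: a line of degree `-1` endomorphisms of the conformal symplectic
algebra. -/
structure SympFlagSymbol {X : Type u} [AddCommGroup X] [Module ℝ X] (G : GradedSympSpace X) where
  line : Submodule ℝ (Module.End ℝ X)
  finrank_line : finrank ℝ line = 1
  line_le : line ≤ G.csp (-2)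

namespace SympFlagSymbol

variable {X : Type u} [AddCommGroup X] [Module ℝ X] {G : GradedSympSpace X} (δ : SympFlagSymbol G)

/-- The algebraic prolongations of the symbol `δ` in `csp(X)`. The natural number `n` stands for the
degree `n / 2 - 1`, so the values are: the line `δ` in degree `-1`, zero in degree `-1/2`, and in
each degree `k ≥ 0` all `A ∈ csp^k(X)` such that `[A, δ]` lies in the prolongation of degree
`k - 1`. -/
def flagProlong : ℕ → Submodule ℝ (Module.End ℝ X)
  | 0 => δ.line
  | 1 => ⊥
  | n + 2 =>
    { carrier := {A | A ∈ G.csp n ∧ ∀ d ∈ δ.line, ⁅A, d⁆ ∈ flagProlong n}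
      zero_mem' := ⟨zero_mem _, fun d _ => by rw [zero_lie]; exact zero_mem _⟩
      add_mem' := by
        rintro A B ⟨hA, hA'⟩ ⟨hB, hB'⟩
        exact ⟨add_mem hA hB, fun d hd => by rw [add_lie]; exact add_mem (hA' d hd) (hB' d hd)⟩
      smul_mem' := by
        rintro a A ⟨hA, hA'⟩
        exact ⟨Submodule.smul_mem _ a hA, fun d hd => by
          rw [smul_lie]; exact Submodule.smul_mem _ a (hA' d hd)⟩ }

/-- The universal algebraic prolongation `u^F(δ)` of the symbol `δ` in `csp(X)`. -/
def uF : Submodule ℝ (Module.End ℝ X) := ⨆ n : ℕ, δ.flagProlong n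

end SympFlagSymbol

/-- The exponential of a nilpotent endomorphism. -/
noncomputable def nilExp {X : Type u} [AddCommGroup X] [Module ℝ X] (x : Module.End ℝ X) :
    Module.End ℝ X :=
  ∑ k ∈ Finset.range (nilpotencyClass x), ((k.factorial : ℝ)⁻¹) • x ^ k

namespace SympFlagSymbol

variable {X : Type u} [AddCommGroup X] [Module ℝ X] {G : GradedSympSpace X} (δ : SympFlagSymbol G)

/-- The flat curve of flags with symbol `δ`, with its parametrization by the line `δ`:
`x ↦ {e^x X_i}_i`. -/
noncomputable def flatCurve (x : δ.line) (i : ℤ) : Submodule ℝ X :=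
  (G.filtration i).map (nilExp (x : Module.End ℝ X))

/-- `𝔩(X)`: the algebra of those elements of `sp(X)` that are infinitesimal symmetries of the flat
curve with symbol `δ` as a parametrized curve, i.e. that preserve every flag of this curve. -/
noncomputable def lX : LieSubalgebra ℝ (Module.End ℝ X) where
  carrier := {A | A ∈ skewAdjointLieSubalgebra G.form ∧
    ∀ (x : δ.line) (i : ℤ), ∀ y ∈ δ.flatCurve x i, A y ∈ δ.flatCurve x i}
  zero_mem' := ⟨zero_mem _, fun x i y _ => by simp⟩
  add_mem' := by
    rintro A B ⟨hA, hA'⟩ ⟨hB, hB'⟩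
    exact ⟨add_mem hA hB, fun x i y hy => add_mem (hA' x i y hy) (hB' x i y hy)⟩
  smul_mem' := by
    rintro a A ⟨hA, hA'⟩
    exact ⟨(skewAdjointLieSubalgebra G.form).smul_mem a hA,
      fun x i y hy => Submodule.smul_mem _ a (hA' x i y hy)⟩
  lie_mem' := by
    rintro A B ⟨hA, hA'⟩ ⟨hB, hB'⟩
    exact ⟨(skewAdjointLieSubalgebra G.form).lie_mem hA hB, fun x i y hy =>
      sub_mem (hA' x i _ (hB' x i y hy)) (hB' x i _ (hA' x i y hy))⟩

end SympFlagSymbol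

/-! ## Skew Young diagrams and tableaux -/

/-- The skew Young diagrams of (modified) Jacobi symbols: finite collections of pairs `(s, l)` of
integers with `0 ≤ l ≤ 2s` (the two-row diagrams of the indecomposable symbols `δ_{s,l}`), and at
most one one-row diagram of an indecomposable symbol `τ_m`, where `tau = some p` encodes
`m = p + 1/2`. -/
structure SkewYoungDiagram where
  num : ℕ
  s : Fin num → ℕ
  l : Fin num → ℕ
  l_le : ∀ k, l k ≤ 2 * s k
  tau : Option ℕ

namespace SkewYoungDiagram

/-- The rows of a diagram: the upper row `upper k` (vectors `e_s, …, e_{s-l}`) and the lower row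
`lower k` (vectors `f_{l-s}, …, f_{-s}`) of the `k`-th two-row component, and the row
`ε_m, …, ε_{-m}` of the component `τ_m`, if there is one. -/
inductive Row (D : SkewYoungDiagram)
  | upper (k : Fin D.num)
  | lower (k : Fin D.num)
  | single (p : ℕ) (h : D.tau = some p)

variable {D : SkewYoungDiagram}

/-- The number of boxes of a row. -/
def Row.boxes : D.Row → ℕ
  | .upper k => D.l k + 1
  | .lower k => D.l k + 1
  | .single p _ => 2 * p + 2

/-- The double of the weight of the leftmost box of a row. -/
def Row.left : D.Row → ℤ
  | .upper k => 2 * (D.s k : ℤ)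
  | .lower k => 2 * ((D.l k : ℤ) - D.s k)
  | .single p _ => 2 * (p : ℤ) + 1

/-- The double of the weight of the rightmost box of a row. The weights drop by `1` at each step to
the right. -/
def Row.right (a : D.Row) : ℤ := a.left - 2 * ((a.boxes : ℤ) - 1)

/-- The boxes of a diagram; in each row they are numbered `0, 1, …` from the left to the right. -/
abbrev Box (D : SkewYoungDiagram) := Σ a : D.Row, Fin a.boxes

/-- The double of the weight of a box. -/
def Box.weight (b : D.Box) : ℤ := b.1.left - 2 * (b.2 : ℕ)

/-- The normal form of the symplectic form: it pairs centrally symmetric boxes, with `+1` for the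
outermost boxes and alternating signs; i.e. `σ(e_i, f_{-i}) = (-1)^{s-i}` and
`σ(ε_i, ε_{-i}) = (-1)^{m-i}`, and all other products (up to skew symmetry) vanish. -/
def pairing : D.Box → D.Box → ℝ
  | ⟨.upper k, i⟩, ⟨.lower k', j⟩ => if k = k' ∧ (i : ℕ) + j = D.l k then (-1) ^ (i : ℕ) else 0
  | ⟨.lower k, i⟩, ⟨.upper k', j⟩ => if k = k' ∧ (i : ℕ) + j = D.l k then -(-1) ^ (j : ℕ) else 0
  | ⟨.single p _, i⟩, ⟨.single _ _, j⟩ => if (i : ℕ) + j = 2 * p + 1 then (-1) ^ (i : ℕ) else 0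
  | _, _ => 0

/-- There are no two rows such that the leftmost box of one of them lies in the same column as, or
to the right of, the rightmost box of the other. (Weights decrease from the left to the right.) -/
def NoSeparatedRows (D : SkewYoungDiagram) : Prop :=
  ∀ a b : D.Row, a ≠ b → ¬ a.left ≤ b.right

/-- The diagram consists of one row with two boxes. -/
def IsSingleRowOfTwo (D : SkewYoungDiagram) : Prop :=
  ∃ a : D.Row, (∀ b : D.Row, b = a) ∧ a.boxes = 2

/-- The row is indexed by `ℤ` (its weights are integers). -/
def Row.IsIntegral (a : D.Row) : Prop := Even a.left

end SkewYoungDiagram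

/-- A skew Young tableau of shape `D` of the symbol `δ`: a filling of the boxes of `D` by vectors of
a homogeneous basis of `X` such that a generator of the line `δ` acts as the right shift and the
symplectic form is, up to a nonzero factor, in normal form. Its existence says that `δ` is isomorphic
to the direct sum of the symbols `δ_{s,l}` and `τ_m` listed in `D`, i.e. that `D` is the skew
Young diagram of `δ`. -/
structure SkewYoungTableau {X : Type u} [AddCommGroup X] [Module ℝ X] {G : GradedSympSpace X}
    (δ : SympFlagSymbol G) (D : SkewYoungDiagram) where
  /-- a generator of the line `δ` -/
  gen : Module.End ℝ X
  span_gen : δ.line = Submodule.span ℝ {gen}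
  basis : Basis D.Box ℝ X
  basis_mem : ∀ b, basis b ∈ G.grading b.weight
  gen_basis : ∀ (a : D.Row) (j : Fin a.boxes),
    gen (basis ⟨a, j⟩) = if h : (j : ℕ) + 1 < a.boxes then basis ⟨a, ⟨j + 1, h⟩⟩ else 0
  /-- the conformal factor -/
  scale : ℝ
  scale_ne_zero : scale ≠ 0
  form_basis : ∀ b b', G.form (basis b) (basis b') = scale * SkewYoungDiagram.pairing b b'

/-! ## Tanaka prolongation over the Heisenberg algebra

The Heisenberg algebra of a symplectic space `(X, σ)` is `η = η^{-1} ⊕ η^{-2}` with `η^{-1} = X` and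
`η^{-2} = ℝ`; its only nonzero brackets are `[v, w] = σ(v, w) ∈ η^{-2}` for `v, w ∈ η^{-1}`. -/

/-- The ambient spaces of the Tanaka prolongations over the Heisenberg algebra; the natural number
`n` stands for the degree `n - 2`. They are `η^{-2}` and `η^{-1}` in the degrees `-2` and `-1`, and
`Hom(η^{-1}, H^{k-1}) ⊕ Hom(η^{-2}, H^{k-2})` in a degree `k ≥ 0`, where `H^j` is the
ambient space of degree `j`. -/
noncomputable def HeisAmbient (X : Type u) [AddCommGroup X] [Module ℝ X] : ℕ → ModuleCat.{u} ℝ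
  | 0 => ModuleCat.of ℝ (ULift.{u} ℝ)
  | 1 => ModuleCat.of ℝ X
  | n + 2 => ModuleCat.of ℝ
      ((X →ₗ[ℝ] HeisAmbient X (n + 1)) × (ℝ →ₗ[ℝ] HeisAmbient X n))

namespace HeisAmbient

variable {X : Type u} [AddCommGroup X] [Module ℝ X]

/-- The restriction `f|_{η^{-1}}` of an element `f` of nonnegative degree. -/
noncomputable def onX (n : ℕ) :
    HeisAmbient X (n + 2) →ₗ[ℝ] (X →ₗ[ℝ] HeisAmbient X (n + 1)) :=
  LinearMap.fst ℝ (X →ₗ[ℝ] HeisAmbient X (n + 1)) (ℝ →ₗ[ℝ] HeisAmbient X n)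

/-- The restriction `f|_{η^{-2}}` of an element `f` of nonnegative degree. -/
noncomputable def onZ (n : ℕ) :
    HeisAmbient X (n + 2) →ₗ[ℝ] (ℝ →ₗ[ℝ] HeisAmbient X n) :=
  LinearMap.snd ℝ (X →ₗ[ℝ] HeisAmbient X (n + 1)) (ℝ →ₗ[ℝ] HeisAmbient X n)

/-- The bracket `[f, v]` with `v ∈ η^{-1}`: it is the bracket of `η` if `f` has negative degree and
`f(v)` otherwise. (In degree `-2` it is zero.) -/
noncomputable def lieX (σ : LinearMap.BilinForm ℝ X) :
    (n : ℕ) → HeisAmbient X n →ₗ[ℝ] X →ₗ[ℝ] HeisAmbient X (n - 1)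
  | 0 => 0
  | 1 => LinearMap.compr₂ (show X →ₗ[ℝ] X →ₗ[ℝ] ℝ from σ)
      (ULift.moduleEquiv.{0, 0, u} (R := ℝ) (M := ℝ)).symm.toLinearMap
  | n + 2 => onX n

/-- The bracket `[f, t]` with `t ∈ η^{-2}`: it is zero if `f` has negative degree and `f(t)`
otherwise. -/
noncomputable def lieZ : (n : ℕ) → HeisAmbient X n →ₗ[ℝ] ℝ →ₗ[ℝ] HeisAmbient X (n - 2)
  | 0 => 0
  | 1 => 0
  | n + 2 => onZ n

/-- The Leibniz rule `f([v, w]) = [f(v), w] + [v, f(w)] = [f(v), w] - [f(w), v]` for all `v, w ∈ η`,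
written out for `v, w ∈ η^{-1}`, and then, where `[v, w] = 0`, for `v ∈ η^{-1}`, `w ∈ η^{-2}` and
for `v, w ∈ η^{-2}`. -/
def IsLeibniz (σ : LinearMap.BilinForm ℝ X) (n : ℕ) (f : HeisAmbient X (n + 2)) : Prop :=
  (∀ v w : X, onZ n f (σ v w) = lieX σ (n + 1) (onX n f v) w - lieX σ (n + 1) (onX n f w) v) ∧
  (∀ (v : X) (t : ℝ), lieZ (n + 1) (onX n f v) t = lieX σ n (onZ n f t) v) ∧
  (∀ t t' : ℝ, lieZ n (onZ n f t) t' = lieZ n (onZ n f t') t)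

/-- The elements that satisfy the Leibniz rule form a subspace. -/
def leibniz (σ : LinearMap.BilinForm ℝ X) (n : ℕ) : Submodule ℝ (HeisAmbient X (n + 2)) where
  carrier := {f | IsLeibniz σ n f}
  zero_mem' := by
    refine ⟨fun v w => by simp, fun v t => ?_, fun t t' => by simp⟩
    simp only [map_zero, LinearMap.zero_apply]
  add_mem' := by
    rintro f g ⟨h1, h2, h3⟩ ⟨k1, k2, k3⟩
    refine ⟨fun v w => ?_, fun v t => ?_, fun t t' => ?_⟩
    · simp only [map_add, LinearMap.add_apply, h1, k1]; abel
    · simp only [map_add, LinearMap.add_apply, h2 v t, k2 v t]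
    · simp only [map_add, LinearMap.add_apply, h3 t t', k3 t t']
  smul_mem' := by
    rintro a f ⟨h1, h2, h3⟩
    refine ⟨fun v w => ?_, fun v t => ?_, fun t t' => ?_⟩
    · simp only [map_smul, LinearMap.smul_apply, h1, smul_sub]
    · simp only [map_smul, LinearMap.smul_apply, h2 v t]
    · simp only [map_smul, LinearMap.smul_apply, h3 t t']

/-- The components of the Tanaka prolongation `u(η, g⁰)`, where `n` stands for the degree `n - 2`:
`η^{-2}`, `η^{-1}`, then `g⁰` (each element of which acts on `η` as a derivation of degree `0`), and
in a degree `k > 0` all `f ∈ Hom(η^{-1}, u^{k-1}) ⊕ Hom(η^{-2}, u^{k-2})` that satisfy the Leibniz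
rule. -/
noncomputable def tanaka (σ : LinearMap.BilinForm ℝ X) (g : Submodule ℝ (Module.End ℝ X)) :
    (n : ℕ) → Submodule ℝ (HeisAmbient X n)
  | 0 => ⊤
  | 1 => ⊤
  | 2 => g.comap (onX 0) ⊓ leibniz σ 0
  | n + 3 =>
    { carrier := {f | (∀ v, onX (n + 1) f v ∈ tanaka σ g (n + 2)) ∧
        (∀ t, onZ (n + 1) f t ∈ tanaka σ g (n + 1)) ∧ f ∈ leibniz σ (n + 1)}
      zero_mem' := ⟨by simp, by simp, zero_mem _⟩
      add_mem' := by
        rintro f h ⟨h1, h2, h3⟩ ⟨k1, k2, k3⟩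
        refine ⟨fun v => ?_, fun t => ?_, add_mem h3 k3⟩
        · rw [map_add]; exact add_mem (h1 v) (k1 v)
        · rw [map_add]; exact add_mem (h2 t) (k2 t)
      smul_mem' := by
        rintro a f ⟨h1, h2, h3⟩
        refine ⟨fun v => ?_, fun t => ?_, Submodule.smul_mem _ a h3⟩
        · rw [map_smul]; exact Submodule.smul_mem _ a (h1 v)
        · rw [map_smul]; exact Submodule.smul_mem _ a (h2 t) }

/-- The restriction to `X = η^{-1}` of an element `f` of degree `n - 1`, as a multilinear map
`(v_1, …, v_n) ↦ f(v_1)(v_2)…(v_n)`. -/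
noncomputable def restrict :
    (n : ℕ) → HeisAmbient X (n + 1) →ₗ[ℝ] MultilinearMap ℝ (fun _ : Fin n => X) X
  | 0 => (MultilinearMap.constLinearEquivOfIsEmpty (R := ℝ) (S := ℝ)
      (M₁ := fun _ : Fin 0 => X) (M₂ := X)).toLinearMap
  | n + 1 =>
    (multilinearCurryLeftEquiv ℝ (fun _ : Fin (n + 1) => X) X).symm.toLinearMap ∘ₗ
      (LinearMap.llcomp ℝ X (HeisAmbient X (n + 1)) _ (restrict n)) ∘ₗ onX n

end HeisAmbient

/-- The `i`-th Tanaka prolongation `u^i(η, g⁰)` of the pair `(η, g⁰)`, where `η` is the Heisenberg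
algebra of `(X, σ)` and `g⁰ ⊆ csp(X)`. -/
noncomputable def tanakaProlong {X : Type u} [AddCommGroup X] [Module ℝ X] (σ : LinearMap.BilinForm ℝ X)
    (g : Submodule ℝ (Module.End ℝ X)) (i : ℕ) : Submodule ℝ (HeisAmbient X (i + 2)) :=
  HeisAmbient.tanaka σ g (i + 2)

/-- The standard `i`-th prolongation `g^{(i)}` of a subspace `g ⊆ gl(X)`: the symmetric multilinear
maps `X^{i+1} → X` that become elements of `g` as soon as all but one argument are fixed. -/
def stdProlong {X : Type u} [AddCommGroup X] [Module ℝ X] (g : Submodule ℝ (Module.End ℝ X))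
    (i : ℕ) : Submodule ℝ (MultilinearMap ℝ (fun _ : Fin (i + 1) => X) X) where
  carrier := {t | (∀ (π : Equiv.Perm (Fin (i + 1))) (v : Fin (i + 1) → X), t (v ∘ π) = t v) ∧
    ∀ (v : Fin (i + 1) → X) (j : Fin (i + 1)), t.toLinearMap v j ∈ g}
  zero_mem' := ⟨by simp, fun v j => zero_mem g⟩
  add_mem' := by
    rintro t t' ⟨h1, h2⟩ ⟨k1, k2⟩
    exact ⟨fun π v => by simp [h1, k1], fun v j => add_mem (h2 v j) (k2 v j)⟩
  smul_mem' := by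
    rintro a t ⟨h1, h2⟩
    exact ⟨fun π v => by simp [h1], fun v j => Submodule.smul_mem g a (h2 v j)⟩

/-! Fix a generator N of the symbol. The theorem reduces to degree one. There an element is a map F
: X → u^F together with its value x₀ ∈ X at 1 ∈ η^{-2}, subject to F(v)w - F(w)v = σ(v,w)x₀;
moreover F(v) scales σ by the factor σ(x₀,v). If always x₀ = 0 and F(v) ∈ 𝔩(X)
(`first_prolongation`), the Leibniz rule forces every element of positive degree to vanish on η^{-2}
and hence to be a symmetric tensor. Conversely such tensors extend by zero, since 𝔩(X) ⊆ u^F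
(`lX_le_uF`). This is `tanaka_eq_stdProlong`.

Two descriptions feed the degree-one statement. Expanding e^{-tN} A e^{tN} in t shows that a skew A
lies in 𝔩(X) iff all its iterated brackets with N preserve the filtration (`mem_lX_iff`). For A ∈
u^F the iterated brackets preserve it up to multiples c_m N, where c_m = 0 for m ≥ 3; and on each
row the diagonal block of A is a gl₂-matrix built from c₀, c₁, c₂ and a scalar μ of that row
(`exists_hasCoefficients`).

Now let v run through a row. The form vanishes on pairs in a row, apart from centrally symmetric
pairs in the half-integral row, so the blocks of F(v_i) on v_j are tridiagonal in j and symmetric in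
i, j. With the given row lengths this linear system has only the zero solution
(`row_coefficients_eq_zero`), so all c_m vanish on row vectors. Finally σ(v₀, (ad N)^m F(w) v₀),
with w dual to the leftmost vector v₀ of a row, is zero by positivity of the weight of v₀, and is a
nonzero multiple of σ(x₀, v_m) by the identities for F (`form_vec_eq_zero`). Hence x₀ = 0, and each
F(v) is skew and lies in 𝔩(X). -/

namespace HeisAmbient

/-! ### Tanaka prolongation versus standard prolongation: reduction to degree one. -/

variable {X : Type u} [AddCommGroup X] [Module ℝ X]

lemma restrict_succ_apply (n : ℕ) (f : HeisAmbient X (n + 2)) (v : Fin (n + 1) → X) :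
    restrict (n + 1) f v = restrict n (onX n f (v 0)) (Fin.tail v) := rfl

lemma restrict_one_apply (f : HeisAmbient X 2) (v : Fin 1 → X) :
    restrict 1 f v = (show X →ₗ[ℝ] X from onX 0 f) (v 0) := rfl

lemma ext_onX_onZ {n : ℕ} {f g : HeisAmbient X (n + 2)} (hX : onX n f = onX n g)
    (hZ : onZ n f = onZ n g) : f = g := Prod.ext hX hZ

/-- The section of the restriction to `X` by elements vanishing on `η^{-2}`. -/
noncomputable def extendByZero :
    (n : ℕ) → MultilinearMap ℝ (fun _ : Fin n => X) X →ₗ[ℝ] HeisAmbient X (n + 1)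
  | 0 => (MultilinearMap.constLinearEquivOfIsEmpty (R := ℝ) (S := ℝ)
      (M₁ := fun _ : Fin 0 => X) (M₂ := X)).symm.toLinearMap
  | n + 1 =>
    (LinearMap.inl ℝ (X →ₗ[ℝ] HeisAmbient X (n + 1)) (ℝ →ₗ[ℝ] HeisAmbient X n)) ∘ₗ
      (LinearMap.llcomp ℝ X _ (HeisAmbient X (n + 1)) (extendByZero n)) ∘ₗ
      (multilinearCurryLeftEquiv ℝ (fun _ : Fin (n + 1) => X) X).toLinearMap

lemma onZ_extendByZero (n : ℕ) (t : MultilinearMap ℝ (fun _ : Fin (n + 1) => X) X) :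
    onZ n (extendByZero (n + 1) t) = 0 := rfl

lemma onX_extendByZero (n : ℕ) (t : MultilinearMap ℝ (fun _ : Fin (n + 1) => X) X) (v : X) :
    onX n (extendByZero (n + 1) t) v = extendByZero n (t.curryLeft v) := rfl

lemma restrict_extendByZero (n : ℕ) (t : MultilinearMap ℝ (fun _ : Fin n => X) X) :
    restrict n (extendByZero n t) = t := by
  induction n with
  | zero =>
    exact (MultilinearMap.constLinearEquivOfIsEmpty (R := ℝ) (S := ℝ)
      (M₁ := fun _ : Fin 0 => X) (M₂ := X)).apply_symm_apply t
  | succ n ih =>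
    ext v
    rw [restrict_succ_apply, onX_extendByZero, ih]
    simp [MultilinearMap.curryLeft_apply]

variable {σ : LinearMap.BilinForm ℝ X} {g : Submodule ℝ (Module.End ℝ X)}

lemma mem_tanaka_two {f : HeisAmbient X 2} :
    f ∈ tanaka σ g 2 ↔ onX 0 f ∈ g ∧ f ∈ leibniz σ 0 := Iff.rfl

lemma mem_tanaka_add_three {n : ℕ} {f : HeisAmbient X (n + 3)} :
    f ∈ tanaka σ g (n + 3) ↔ (∀ v, onX (n + 1) f v ∈ tanaka σ g (n + 2)) ∧
      (∀ t, onZ (n + 1) f t ∈ tanaka σ g (n + 1)) ∧ f ∈ leibniz σ (n + 1) := Iff.rfl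

/-- The action on `η^{-2}` of an element of degree `0` is the conformal factor of its action
on `X`. -/
lemma onZ_form_down {f : HeisAmbient X 2} (hf : f ∈ leibniz σ 0) (v w : X) :
    (show ULift.{u} ℝ from onZ 0 f (σ v w)).down =
      σ ((show X →ₗ[ℝ] X from onX 0 f) v) w - σ ((show X →ₗ[ℝ] X from onX 0 f) w) v :=
  congrArg ULift.down (hf.1 v w)

/-- A nonzero σ makes η^{-1} generate η^{-2}, so a derivation of degree 0 is determined by its
action on X. -/
lemma eq_zero_of_onX_eq_zero (hσ : ∃ v w, σ v w ≠ 0) {f : HeisAmbient X 2}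
    (hf : f ∈ leibniz σ 0) (h : onX 0 f = 0) : f = 0 := by
  refine ext_onX_onZ (by rw [h, map_zero]) ?_
  obtain ⟨v, w, hvw⟩ := hσ
  have h1 := hf.1 v w
  rw [h] at h1
  simp only [LinearMap.zero_apply, map_zero, sub_zero] at h1
  rw [map_zero]
  ext
  rw [LinearMap.zero_apply, ← div_self hvw, div_eq_inv_mul, ← smul_eq_mul, map_smul, h1, smul_zero]

/-- Elements of the Tanaka prolongations of positive degree vanish on `η^{-2}` as soon as those of
degree one do. -/
lemma onZ_eq_zero (hσ : ∃ v w, σ v w ≠ 0)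
    (h1 : ∀ f ∈ tanaka σ g 3, onZ 1 f = 0) (n : ℕ) :
    ∀ f ∈ tanaka σ g (n + 3), onZ (n + 1) f = 0 := by
  induction n using Nat.strong_induction_on with
  | _ n ih =>
  match n with
  | 0 => exact h1
  | n + 1 =>
    intro f hf
    rw [mem_tanaka_add_three] at hf
    obtain ⟨hX, hZ, hL⟩ := hf
    -- The Leibniz rule gives [f(v), t] = [f(t), v], and f(v), one degree lower, already vanishes on
    -- η^{-2}; so f(t) kills X.
    have key : ∀ t, onX n (onZ (n + 2) f t) = 0 := by
      intro t
      ext v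
      have h := hL.2.1 v t
      have h0 : lieZ (n + 1 + 1 + 1) (onX (n + 2) f v) t = 0 := by
        change onZ (n + 1) (onX (n + 2) f v) t = 0
        rw [ih n (by omega) _ (hX v), LinearMap.zero_apply]
      exact h.symm.trans h0
    refine LinearMap.ext fun t => ?_
    rw [LinearMap.zero_apply]
    -- Here f(t) has degree n. In degree 0 killing X suffices; in positive degree the induction
    -- hypothesis also kills η^{-2}.
    match n, ih, f, hX, hZ, hL, key with
    | 0, ih, f, hX, hZ, hL, key =>
      exact eq_zero_of_onX_eq_zero hσ (mem_tanaka_two.1 (hZ t)).2 (key t)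
    | n + 1, ih, f, hX, hZ, hL, key =>
      refine ext_onX_onZ ((key t).trans (map_zero _).symm) ?_
      rw [map_zero]
      exact ih n (by omega) _ (hZ t)

lemma eq_zero_of_restrict_eq_zero (hσ : ∃ v w, σ v w ≠ 0)
    (h1 : ∀ f ∈ tanaka σ g 3, onZ 1 f = 0) (n : ℕ) :
    ∀ f ∈ tanaka σ g (n + 2), restrict (n + 1) f = 0 → f = 0 := by
  induction n with
  | zero =>
    intro f hf h
    refine eq_zero_of_onX_eq_zero hσ hf.2 (LinearMap.ext fun v => ?_)
    have := congrArg (fun t => t fun _ => v) h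
    exact this
  | succ n ih =>
    intro f hf h
    refine ext_onX_onZ ?_ ((onZ_eq_zero hσ h1 n f hf).trans (map_zero _).symm)
    rw [map_zero]
    refine LinearMap.ext fun v => ih _ (hf.1 v) ?_
    ext w
    have := congrArg (fun t => t (Fin.cons v w)) h
    simpa [restrict_succ_apply (n + 1)] using this

/-- A multilinear map that is symmetric in all arguments but the first, for each value of the
first one, and symmetric in the first two arguments, is symmetric. -/
lemma _root_.MultilinearMap.symmetric_of_curryLeft {n : ℕ}
    (t : MultilinearMap ℝ (fun _ : Fin (n + 2) => X) X)
    (h1 : ∀ v (π : Equiv.Perm (Fin (n + 1))) w, t.curryLeft v (w ∘ π) = t.curryLeft v w)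
    (h2 : ∀ v w u, t (Fin.cons v (Fin.cons w u)) = t (Fin.cons w (Fin.cons v u)))
    (π : Equiv.Perm (Fin (n + 2))) (v : Fin (n + 2) → X) : t (v ∘ π) = t v := by
  -- Adjacent transpositions generate the symmetric group: the first one is `h2`, the others fix the
  -- first argument and come from `h1`.
  have hmem : π ∈ Submonoid.closure
      (Set.range fun i : Fin (n + 1) ↦ Equiv.swap i.castSucc i.succ) := by
    rw [Equiv.Perm.mclosure_swap_castSucc_succ]; trivial
  induction hmem using Submonoid.closure_induction generalizing v with
  | one => rfl
  | mul π ρ _ _ hπ hρ =>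
    rw [Equiv.Perm.coe_mul, ← Function.comp_assoc, hρ, hπ]
  | mem π h =>
    obtain ⟨i, rfl⟩ := h
    refine Fin.cases ?_ (fun j => ?_) i
    · have h := h2 (v 1) (v 0) (fun k => v k.succ.succ)
      convert h using 2
      · ext k
        refine Fin.cases (by simp) (fun k => Fin.cases (by simp) (fun k => ?_) k) k
        simp only [Function.comp_apply, Fin.cons_succ]
        rw [Equiv.swap_apply_of_ne_of_ne]
        · simp
        · exact fun h => Fin.succ_ne_zero k (Fin.succ_injective _ h)
      · ext k
        refine Fin.cases (by simp) (fun k => Fin.cases (by simp) (fun k => by simp) k) k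
    · have h := h1 (v 0) (Equiv.swap j.castSucc j.succ) (Fin.tail v)
      simp only [MultilinearMap.curryLeft_apply] at h
      convert h using 2
      · ext k
        refine Fin.cases ?_ (fun k => ?_) k
        · simp only [Function.comp_apply, Fin.cons_zero]
          rw [Equiv.swap_apply_of_ne_of_ne (by simp [Fin.ext_iff]) (by simp [Fin.ext_iff])]
        · simp only [Function.comp_apply, Fin.cons_succ, Fin.tail]
          rw [Fin.castSucc_succ, (Fin.succ_injective _).swap_apply]
      · simp

variable {h : Submodule ℝ (Module.End ℝ X)}

lemma mem_stdProlong {n : ℕ} {t : MultilinearMap ℝ (fun _ : Fin (n + 1) => X) X} :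
    t ∈ stdProlong h n ↔
      (∀ (π : Equiv.Perm (Fin (n + 1))) (v : Fin (n + 1) → X), t (v ∘ π) = t v) ∧
      ∀ (v : Fin (n + 1) → X) (j : Fin (n + 1)), t.toLinearMap v j ∈ h := Iff.rfl

lemma toLinearMap_succ {n : ℕ} (t : MultilinearMap ℝ (fun _ : Fin (n + 2) => X) X)
    (v : Fin (n + 2) → X) (j : Fin (n + 1)) :
    t.toLinearMap v j.succ = (t.curryLeft (v 0)).toLinearMap (Fin.tail v) j := by
  ext x
  simp only [MultilinearMap.toLinearMap_apply, MultilinearMap.curryLeft_apply]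
  congr 1
  rw [Fin.cons_update, Fin.cons_self_tail]

lemma curryLeft_mem_stdProlong {n : ℕ} {t : MultilinearMap ℝ (fun _ : Fin (n + 2) => X) X}
    (ht : t ∈ stdProlong h (n + 1)) (v : X) : t.curryLeft v ∈ stdProlong h n := by
  obtain ⟨hs, hl⟩ := mem_stdProlong.1 ht
  refine mem_stdProlong.2 ⟨fun π w => ?_, fun w j => ?_⟩
  · have := hs (Equiv.Perm.decomposeFin.symm (0, π)) (Fin.cons v w)
    simp only [MultilinearMap.curryLeft_apply]
    rw [← this]
    congr 1
    ext k
    refine Fin.cases (by simp) (fun k => by simp) k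
  · have := hl (Fin.cons v w) j.succ
    rwa [toLinearMap_succ, Fin.cons_zero, Fin.tail_cons] at this

lemma mem_stdProlong_succ {n : ℕ} {t : MultilinearMap ℝ (fun _ : Fin (n + 2) => X) X}
    (h1 : ∀ v, t.curryLeft v ∈ stdProlong h n)
    (h2 : ∀ v w u, t (Fin.cons v (Fin.cons w u)) = t (Fin.cons w (Fin.cons v u))) :
    t ∈ stdProlong h (n + 1) := by
  have hs := t.symmetric_of_curryLeft (fun v => (mem_stdProlong.1 (h1 v)).1) h2
  have hl : ∀ (v : Fin (n + 2) → X) (j : Fin (n + 1)), t.toLinearMap v j.succ ∈ h := by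
    intro v j
    rw [toLinearMap_succ]
    exact (mem_stdProlong.1 (h1 _)).2 _ _
  refine mem_stdProlong.2 ⟨hs, fun v j => ?_⟩
  refine Fin.cases ?_ (hl v) j
  -- Only slot 0 is left; by symmetry it is exchanged with slot 1, which is already covered.
  have := hl (v ∘ Equiv.swap 0 1) 0
  convert this using 1
  ext x
  simp only [MultilinearMap.toLinearMap_apply]
  rw [← hs (Equiv.swap 0 1)]
  congr 1
  ext k
  by_cases h0 : k = 0
  · subst h0; simp [Function.update]
  by_cases h1 : k = 1
  · subst h1; simp
  · have hk : Equiv.swap (0 : Fin (n + 2)) 1 k = k := Equiv.swap_apply_of_ne_of_ne h0 h1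
    simp [Function.update, hk, h0, h1]

lemma onX_onX_comm {n : ℕ} {f : HeisAmbient X (n + 3)} (hf : f ∈ leibniz σ (n + 1))
    (hZ : onZ (n + 1) f = 0) (v w : X) :
    onX n (onX (n + 1) f v) w = onX n (onX (n + 1) f w) v := by
  have h := hf.1 v w
  rw [hZ, LinearMap.zero_apply] at h
  exact sub_eq_zero.1 h.symm

/-- Elements vanishing on η^{-2} satisfy [f(v), w] = [f(w), v], which is symmetry in the first two
arguments; the remaining symmetry and the membership in `h` are inherited from f(v). -/
lemma restrict_mem_stdProlong (hσ : ∃ v w, σ v w ≠ 0)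
    (h1 : ∀ f ∈ tanaka σ g 3, onZ 1 f = 0 ∧ ∀ v, onX 0 (onX 1 f v) ∈ h) (n : ℕ) :
    ∀ f ∈ tanaka σ g (n + 3), restrict (n + 2) f ∈ stdProlong h (n + 1) := by
  have hZ := onZ_eq_zero hσ fun f hf => (h1 f hf).1
  have symm : ∀ n, ∀ f ∈ tanaka σ g (n + 3), ∀ v w u, restrict (n + 2) f
      (Fin.cons v (Fin.cons w u)) = restrict (n + 2) f (Fin.cons w (Fin.cons v u)) := by
    intro n f hf v w u
    have := onX_onX_comm hf.2.2 (hZ n f hf) v w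
    simp only [restrict_succ_apply (n + 1), restrict_succ_apply n, Fin.cons_zero, Fin.tail_cons]
    rw [this]
  induction n with
  | zero =>
    intro f hf
    refine mem_stdProlong_succ (fun v => mem_stdProlong.2 ⟨fun π w => ?_, fun w j => ?_⟩)
      (symm 0 f hf)
    · have : Subsingleton (Fin (0 + 1)) := inferInstanceAs (Subsingleton (Fin 1))
      rw [Subsingleton.elim π 1]; rfl
    · obtain rfl : j = 0 := Fin.fin_one_eq_zero j
      have e : ((restrict (0 + 2) f).curryLeft v).toLinearMap w 0 =
          (show X →ₗ[ℝ] X from onX 0 (onX 1 f v)) := by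
        ext x
        rw [MultilinearMap.toLinearMap_apply, MultilinearMap.curryLeft_apply,
          restrict_succ_apply 1]
        simp only [Fin.tail_cons, Fin.cons_zero]
        exact (restrict_one_apply _ _).trans (by simp)
      rw [e]
      exact (h1 f hf).2 v
  | succ n ih =>
    intro f hf
    refine mem_stdProlong_succ (fun v => ?_) (symm _ f hf)
    have := ih _ (hf.1 v)
    convert this using 1
    ext w
    simp [MultilinearMap.curryLeft_apply, restrict_succ_apply (n + 2)]

/-- Elements of `h` have conformal factor 0, so acting by zero on η^{-2} is consistent with the
Leibniz rule in degree 0; in higher degrees the rule is the symmetry of the tensor. -/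
lemma extendByZero_mem_tanaka (hg : h ≤ g) (hskew : ∀ A ∈ h, ∀ v w, σ (A v) w = σ (A w) v)
    (n : ℕ) : ∀ t ∈ stdProlong h n, extendByZero (n + 1) t ∈ tanaka σ g (n + 2) := by
  induction n with
  | zero =>
    intro t ht
    have hA : onX 0 (extendByZero 1 t) ∈ h := by
      have e : (show X →ₗ[ℝ] X from onX 0 (extendByZero 1 t)) = t.toLinearMap 0 0 := by
        refine LinearMap.ext fun x => ?_
        rw [MultilinearMap.toLinearMap_apply]
        change t.curryLeft x _ = _
        rw [MultilinearMap.curryLeft_apply]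
        congr 1
        ext k
        obtain rfl : k = 0 := Fin.fin_one_eq_zero k
        simp
      have := (mem_stdProlong.1 ht).2 0 0
      rwa [← e] at this
    refine mem_tanaka_two.2 ⟨hg hA, fun v w => ?_, fun _ _ => rfl, fun _ _ => rfl⟩
    rw [onZ_extendByZero, LinearMap.zero_apply]
    symm
    rw [sub_eq_zero]
    exact congrArg ULift.up (hskew _ hA v w)
  | succ n ih =>
    intro t ht
    refine mem_tanaka_add_three.2 ⟨fun v => ?_, fun s => ?_, fun v w => ?_, fun v s => ?_,
      fun s s' => ?_⟩
    · rw [onX_extendByZero]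
      exact ih _ (curryLeft_mem_stdProlong ht v)
    · rw [onZ_extendByZero]; exact zero_mem _
    · rw [onZ_extendByZero, LinearMap.zero_apply]
      symm
      rw [sub_eq_zero]
      change onX n (extendByZero (n + 1) (t.curryLeft v)) w =
        onX n (extendByZero (n + 1) (t.curryLeft w)) v
      rw [onX_extendByZero, onX_extendByZero]
      congr 1
      ext u
      simp only [MultilinearMap.curryLeft_apply]
      rw [← (mem_stdProlong.1 ht).1 (Equiv.swap 0 1)]
      congr 1
      ext k
      refine Fin.cases (by simp) (fun k => Fin.cases (by simp) (fun k => ?_) k) k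
      simp only [Function.comp_apply, Fin.cons_succ]
      have hk : Equiv.swap (0 : Fin (n + 2)) 1 k.succ.succ = k.succ.succ :=
        Equiv.swap_apply_of_ne_of_ne (Fin.succ_ne_zero _)
          fun h => Fin.succ_ne_zero k (Fin.succ_injective _ h)
      rw [hk]
      simp
    · rw [onZ_extendByZero]
      simp only [LinearMap.zero_apply, map_zero]
      exact LinearMap.congr_fun (onZ_extendByZero n (t.curryLeft v)) s
    · rw [onZ_extendByZero]; simp

/-- The Tanaka prolongations of positive degree coincide with the standard prolongations of `h`
as soon as the first one takes values in `h` and vanishes on `η^{-2}`. -/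
theorem tanaka_eq_stdProlong (hσ : ∃ v w, σ v w ≠ 0) (hg : h ≤ g)
    (hskew : ∀ A ∈ h, ∀ v w, σ (A v) w = σ (A w) v)
    (h1 : ∀ f ∈ tanaka σ g 3, onZ 1 f = 0 ∧ ∀ v, onX 0 (onX 1 f v) ∈ h) (n : ℕ) :
    Set.InjOn (restrict (n + 2)) (tanaka σ g (n + 3) : Set (HeisAmbient X (n + 3))) ∧
      (tanaka σ g (n + 3)).map (restrict (n + 2)) = stdProlong h (n + 1) := by
  refine ⟨fun f hf f' hf' hff => ?_, le_antisymm ?_ fun t ht => ?_⟩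
  · rw [← sub_eq_zero]
    refine eq_zero_of_restrict_eq_zero hσ (fun f hf => (h1 f hf).1) (n + 1) _
      (sub_mem hf hf') ?_
    rw [map_sub, hff, sub_self]
  · rintro _ ⟨f, hf, rfl⟩
    exact restrict_mem_stdProlong hσ h1 n f hf
  · exact ⟨_, extendByZero_mem_tanaka hg hskew (n + 1) t ht, restrict_extendByZero _ t⟩

end HeisAmbient

/-! ### Rows, central symmetry of boxes, and signs of weights. -/

namespace SkewYoungDiagram

variable {D : SkewYoungDiagram}

lemma Row.boxes_pos (a : D.Row) : 0 < a.boxes := by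
  cases a <;> simp [Row.boxes]

/-- The box that is centrally symmetric to a given one. -/
def Box.dual : D.Box → D.Box
  | ⟨.upper k, i⟩ => ⟨.lower k, Fin.rev (n := D.l k + 1) i⟩
  | ⟨.lower k, i⟩ => ⟨.upper k, Fin.rev (n := D.l k + 1) i⟩
  | ⟨.single p h, i⟩ => ⟨.single p h, i.rev⟩

lemma Box.weight_dual (b : D.Box) : Box.weight (Box.dual b) = -Box.weight b := by
  rcases b with ⟨(k | k | ⟨p, hp⟩), ⟨i, hi⟩⟩ <;>
  simp only [Row.boxes] at hi <;>
  simp only [Box.dual, Box.weight, Row.left, Row.boxes, Fin.val_rev] <;>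
  rw [Nat.cast_sub (Nat.succ_le_of_lt hi)] <;> push_cast <;> ring

lemma Box.dual_last (a : D.Row) :
    ((Box.dual ⟨a, ⟨0, a.boxes_pos⟩⟩).2 : ℕ) + 1 = (Box.dual ⟨a, ⟨0, a.boxes_pos⟩⟩).1.boxes := by
  rcases a with (k | k | ⟨p, hp⟩) <;> simp [Box.dual, Row.boxes]

lemma pairing_dual_self (b : D.Box) : pairing b (Box.dual b) ≠ 0 := by
  rcases b with ⟨(k | k | ⟨p, hp⟩), ⟨i, hi⟩⟩ <;>
  simp only [Row.boxes] at hi <;>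
  simp only [Box.dual, pairing, Row.boxes, Fin.val_rev]
  · rw [if_pos ⟨trivial, by omega⟩]; simp
  · rw [if_pos ⟨trivial, by omega⟩]; simp
  · rw [if_pos (by omega)]; simp

lemma pairing_dual_of_ne {b b' : D.Box} (h : b ≠ b') : pairing b (Box.dual b') = 0 := by
  rcases b with ⟨(k | k | ⟨p, hp⟩), ⟨i, hi⟩⟩ <;>
  rcases b' with ⟨(k' | k' | ⟨p', hp'⟩), ⟨i', hi'⟩⟩ <;>
  simp only [Row.boxes] at hi hi' <;>
  simp only [Box.dual, pairing, Row.boxes, Fin.val_rev]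
  · refine if_neg ?_
    rintro ⟨rfl, h2⟩
    obtain rfl : i = i' := by omega
    exact h rfl
  · refine if_neg ?_
    rintro ⟨rfl, h2⟩
    obtain rfl : i = i' := by omega
    exact h rfl
  · obtain rfl : p = p' := by simpa [hp] using hp'
    refine if_neg fun h2 => ?_
    obtain rfl : i = i' := by omega
    exact h rfl

lemma pairing_row (a : D.Row) (i j : Fin a.boxes)
    (h : ¬ a.IsIntegral → (i : ℕ) + j + 1 ≠ a.boxes) :
    pairing (⟨a, i⟩ : D.Box) ⟨a, j⟩ = 0 := by
  rcases a with (k | k | ⟨p, hp⟩)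
  · rfl
  · rfl
  · have := h (by simp [Row.IsIntegral, Row.left])
    simp only [Row.boxes] at this
    exact if_neg (by omega)

/-- In a diagram without separated rows the leftmost boxes have positive weights. -/
lemma NoSeparatedRows.left_pos (h : D.NoSeparatedRows) (a : D.Row) : 0 < a.left := by
  rcases a with (k | k | ⟨p, hp⟩)
  · have := h (.upper k) (.lower k) (by simp)
    simp only [Row.left, Row.right, Row.boxes] at *
    push_cast at this
    omega
  · have := h (.lower k) (.upper k) (by simp)
    simp only [Row.left, Row.right, Row.boxes] at *
    push_cast at this
    omega
  · simp only [Row.left]; omega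

end SkewYoungDiagram

/-! ### The filtration and its compatibility with the form. -/

namespace GradedSympSpace

variable {X : Type u} [AddCommGroup X] [Module ℝ X] (G : GradedSympSpace X)

lemma grading_le_filtration {i j : ℤ} (h : i ≤ j) : G.grading j ≤ G.filtration i :=
  le_iSup₂_of_le j h le_rfl

lemma form_eq_zero_of_mem_filtration {i j : ℤ} (h : 0 < i + j) {x y : X} (hx : x ∈ G.grading i)
    (hy : y ∈ G.filtration j) : G.form x y = 0 := by
  have : G.filtration j ≤ LinearMap.ker (G.form x) :=
    iSup₂_le fun k hk y hy => G.form_eq_zero i k (by omega) x hx y hy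
  exact this hy

/-- The endomorphisms that preserve the filtration. -/
def filtrationPreserving : Submodule ℝ (Module.End ℝ X) where
  carrier := {A | ∀ i, ∀ x ∈ G.filtration i, A x ∈ G.filtration i}
  zero_mem' := fun _ _ _ => zero_mem _
  add_mem' := fun hA hB i x hx => add_mem (hA i x hx) (hB i x hx)
  smul_mem' := fun c _ hA i x hx => Submodule.smul_mem _ c (hA i x hx)

lemma csp_le_filtrationPreserving {j : ℤ} (hj : 0 ≤ j) : G.csp j ≤ G.filtrationPreserving := by
  rintro A ⟨-, hA⟩ i
  have : G.filtration i ≤ (G.filtration i).comap A :=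
    iSup₂_le fun k hk y hy => G.grading_le_filtration (by omega) (hA k y hy)
  exact this

lemma form_swap (x y : X) : G.form x y = -G.form y x := by
  rw [← G.isAlt.neg_eq y x]

end GradedSympSpace

/-! ### Rows as Jordan chains of N, and coordinates along them. -/

namespace SkewYoungTableau

variable {X : Type u} [AddCommGroup X] [Module ℝ X] {G : GradedSympSpace X}
  {δ : SympFlagSymbol G} {D : SkewYoungDiagram} (T : SkewYoungTableau δ D)

open SkewYoungDiagram

/-- The coefficient of the pairing between a box and its dual. -/
noncomputable def dualCoeff (b : D.Box) : ℝ := T.scale * pairing b (Box.dual b)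

lemma dualCoeff_ne_zero (b : D.Box) : T.dualCoeff b ≠ 0 :=
  mul_ne_zero T.scale_ne_zero (pairing_dual_self b)

lemma form_dual (b : D.Box) (y : X) :
    G.form y (T.basis (Box.dual b)) = T.dualCoeff b * T.basis.coord b y := by
  have : G.form.flip (T.basis (Box.dual b)) = T.dualCoeff b • T.basis.coord b := by
    refine T.basis.ext fun b' => ?_
    rw [LinearMap.BilinForm.flip_apply, T.form_basis, LinearMap.smul_apply, Basis.coord_apply,
      Basis.repr_self, smul_eq_mul]
    by_cases h : b' = b
    · subst h; simp [dualCoeff]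
    · rw [pairing_dual_of_ne h]; simp [h]
  simpa using LinearMap.congr_fun this y

/-- By `form_dual` the coordinate at a box is a pairing with the dual basis vector, whose weight is
opposite. -/
lemma coord_eq_zero {b : D.Box} {i : ℤ} (h : Box.weight b ≠ i) {y : X} (hy : y ∈ G.grading i) :
    T.basis.coord b y = 0 := by
  have h1 := T.form_dual b y
  rw [G.form_eq_zero i (Box.weight (Box.dual b)) (by rw [Box.weight_dual]; omega) y hy _
    (T.basis_mem _)] at h1
  exact (mul_eq_zero.1 h1.symm).resolve_left (T.dualCoeff_ne_zero b)

lemma gen_mem_line : T.gen ∈ δ.line := by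
  rw [T.span_gen]; exact Submodule.mem_span_singleton_self _

lemma gen_mem_csp : T.gen ∈ G.csp (-2) := δ.line_le T.gen_mem_line

/-- The symbol is a line, so X is not zero. -/
lemma nonempty_row (T : SkewYoungTableau δ D) : Nonempty D.Row := by
  by_contra h
  rw [not_nonempty_iff] at h
  have : Subsingleton X := T.basis.repr.toEquiv.injective.subsingleton
  have : Subsingleton δ.line := inferInstance
  have h1 := δ.finrank_line
  rw [finrank_zero_of_subsingleton] at h1
  exact zero_ne_one h1

lemma exists_form_ne_zero (T : SkewYoungTableau δ D) : ∃ v w, G.form v w ≠ 0 := by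
  obtain ⟨a⟩ := T.nonempty_row
  refine ⟨T.basis ⟨a, ⟨0, a.boxes_pos⟩⟩, T.basis (Box.dual ⟨a, ⟨0, a.boxes_pos⟩⟩), ?_⟩
  rw [T.form_dual]
  simpa using T.dualCoeff_ne_zero _

/-- The vectors of a row, continued by zero. -/
noncomputable def vec (a : D.Row) (j : ℕ) : X := (T.gen ^ j) (T.basis ⟨a, ⟨0, a.boxes_pos⟩⟩)

lemma gen_vec (a : D.Row) (j : ℕ) : T.gen (T.vec a j) = T.vec a (j + 1) := by
  rw [vec, vec, pow_succ', Module.End.mul_apply]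

lemma gen_pow_vec (a : D.Row) (m j : ℕ) : (T.gen ^ m) (T.vec a j) = T.vec a (m + j) := by
  rw [vec, vec, pow_add, Module.End.mul_apply]

lemma vec_eq_basis {a : D.Row} {j : ℕ} (h : j < a.boxes) : T.vec a j = T.basis ⟨a, ⟨j, h⟩⟩ := by
  induction j with
  | zero => rfl
  | succ j ih => rw [← gen_vec, ih (by omega), T.gen_basis, dif_pos h]

lemma vec_eq_zero {a : D.Row} {j : ℕ} (h : a.boxes ≤ j) : T.vec a j = 0 := by
  induction j, h using Nat.le_induction with
  | base =>
    obtain ⟨p, hp⟩ : ∃ p, a.boxes = p + 1 := ⟨a.boxes - 1, by have := a.boxes_pos; omega⟩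
    rw [hp, ← gen_vec, T.vec_eq_basis (by omega), T.gen_basis, dif_neg (by simp [hp])]
  | succ j _ ih => rw [← gen_vec, ih, map_zero]

lemma vec_mem (a : D.Row) (j : ℕ) : T.vec a j ∈ G.grading (a.left - 2 * j) := by
  by_cases h : j < a.boxes
  · rw [T.vec_eq_basis h]; exact T.basis_mem ⟨a, ⟨j, h⟩⟩
  · rw [T.vec_eq_zero (not_lt.1 h)]; exact zero_mem _

/-- The coordinates along a row. -/
noncomputable def rowCoord (a : D.Row) (k : ℕ) : X →ₗ[ℝ] ℝ :=
  if h : k < a.boxes then T.basis.coord ⟨a, ⟨k, h⟩⟩ else 0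

lemma rowCoord_vec {a : D.Row} {k : ℕ} (hk : k < a.boxes) (j : ℕ) :
    T.rowCoord a k (T.vec a j) = if k = j then 1 else 0 := by
  classical
  rw [rowCoord, dif_pos hk]
  by_cases h : j < a.boxes
  · rw [T.vec_eq_basis h, Basis.coord_apply, Basis.repr_self, Finsupp.single_apply]
    simp [Fin.ext_iff, eq_comm]
  · rw [T.vec_eq_zero (not_lt.1 h), map_zero, if_neg (by omega)]

lemma rowCoord_eq_zero {a : D.Row} {k : ℕ} {i : ℤ} (h : a.left - 2 * k ≠ i) {y : X}
    (hy : y ∈ G.grading i) : T.rowCoord a k y = 0 := by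
  rw [rowCoord]
  split_ifs with hk
  · exact T.coord_eq_zero (b := ⟨a, ⟨k, hk⟩⟩) h hy
  · rfl

lemma rowCoord_gen_zero (a : D.Row) (y : X) : T.rowCoord a 0 (T.gen y) = 0 := by
  have : T.rowCoord a 0 ∘ₗ T.gen = 0 := by
    refine T.basis.ext fun ⟨b, j⟩ => ?_
    rw [rowCoord, dif_pos a.boxes_pos, LinearMap.comp_apply, T.gen_basis]
    split_ifs
    · simp only [Basis.coord_apply, Basis.repr_self, LinearMap.zero_apply]
      refine Finsupp.single_eq_of_ne ?_
      rintro ⟨⟩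
    · simp
  exact LinearMap.congr_fun this y

lemma rowCoord_gen_succ {a : D.Row} {k : ℕ} (hk : k + 1 < a.boxes) (y : X) :
    T.rowCoord a (k + 1) (T.gen y) = T.rowCoord a k y := by
  classical
  have : T.rowCoord a (k + 1) ∘ₗ T.gen = T.rowCoord a k := by
    refine T.basis.ext fun ⟨b, j⟩ => ?_
    rw [rowCoord, rowCoord, dif_pos hk, dif_pos (by omega), LinearMap.comp_apply, T.gen_basis]
    by_cases hab : a = b
    · subst hab
      split_ifs with h
      · simp [Finsupp.single_apply, Fin.ext_iff]
      · simp only [map_zero, Basis.coord_apply, Basis.repr_self]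
        rw [Finsupp.single_apply, if_neg]
        simp only [Sigma.mk.injEq, heq_eq_eq, true_and, Fin.ext_iff]
        omega
    · split_ifs
      · simp only [Basis.coord_apply, Basis.repr_self, Finsupp.single_apply]
        rw [if_neg, if_neg] <;>
        · intro h; exact hab (congrArg Sigma.fst h).symm
      · simp only [map_zero, Basis.coord_apply, Basis.repr_self, Finsupp.single_apply]
        rw [if_neg]
        intro h; exact hab (congrArg Sigma.fst h).symm
  exact LinearMap.congr_fun this y

lemma rowCoord_gen_pow {a : D.Row} {k : ℕ} (hk : k < a.boxes) (m : ℕ) (y : X) :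
    T.rowCoord a k ((T.gen ^ m) y) = if m ≤ k then T.rowCoord a (k - m) y else 0 := by
  induction m generalizing k with
  | zero => simp
  | succ m ih =>
    rw [pow_succ', Module.End.mul_apply]
    cases k with
    | zero => simp [rowCoord_gen_zero]
    | succ k => simp [T.rowCoord_gen_succ hk, ih (k := k) (by omega)]

/-- The conformal factor of N is tested on the leftmost box of a row and its dual. The dual box ends
its row, so N kills it, and the image of N has no component along a leftmost box; hence the factor
is 0. -/
lemma form_gen (x y : X) : G.form (T.gen x) y = -G.form x (T.gen y) := by
  obtain ⟨⟨c, hc⟩, -⟩ := T.gen_mem_csp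
  obtain ⟨a⟩ := T.nonempty_row
  have h := hc (T.vec a 0) (T.basis (Box.dual ⟨a, ⟨0, a.boxes_pos⟩⟩))
  have h0 : T.gen (T.basis (Box.dual ⟨a, ⟨0, a.boxes_pos⟩⟩)) = 0 := by
    have := T.gen_basis _ (Box.dual ⟨a, ⟨0, a.boxes_pos⟩⟩).2
    rw [dif_neg (by have := Box.dual_last a; omega)] at this
    exact this
  have h1 : G.form (T.vec a 0) (T.basis (Box.dual ⟨a, ⟨0, a.boxes_pos⟩⟩)) ≠ 0 := by
    rw [form_dual, T.vec_eq_basis a.boxes_pos]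
    simpa using T.dualCoeff_ne_zero _
  have h2 : G.form (T.gen (T.vec a 0)) (T.basis (Box.dual ⟨a, ⟨0, a.boxes_pos⟩⟩)) = 0 := by
    have := T.rowCoord_gen_zero a (T.vec a 0)
    rw [rowCoord, dif_pos a.boxes_pos] at this
    rw [form_dual, this, mul_zero]
  rw [h0, h2, map_zero, add_zero, zero_eq_mul] at h
  have := hc x y
  rw [h.resolve_right h1, zero_mul] at this
  linarith

lemma form_gen_pow (m : ℕ) (x y : X) :
    G.form ((T.gen ^ m) x) y = (-1) ^ m * G.form x ((T.gen ^ m) y) := by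
  induction m generalizing x y with
  | zero => simp
  | succ m ih =>
    rw [pow_succ', Module.End.mul_apply, form_gen, ih, ← Module.End.mul_apply, ← pow_succ, pow_succ',
      pow_succ' (-1 : ℝ)]
    ring

end SkewYoungTableau

/-! ### The linear system on a single row. -/

/-- Algebraic core of the vanishing of the diagonal blocks: the coefficients of a `gl₂`-valued
symmetric tensor on a row. -/
lemma row_coefficients_eq_zero {p : ℕ} (hp : 4 ≤ p) {t : Prop} (ht : t → 6 ≤ p)
    (c₀ c₁ c₂ μ : ℕ → ℝ) (M : ℕ → ℕ → ℕ → ℝ)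
    (hM : ∀ i j k, M i j k = (if k = j + 1 then c₀ i else 0) +
      (if k = j then μ i + c₁ i * j else 0) +
      (if k + 1 = j then c₂ i / 2 * (j * ((j : ℝ) - p)) else 0))
    (H : ∀ i j k, i < p → j < p → k < p → (t → i + j + 1 ≠ p) → M i j k = M j i k) :
    ∀ i < p, c₀ i = 0 ∧ c₁ i = 0 ∧ c₂ i = 0 ∧ μ i = 0 := by
  have hpR : (4 : ℝ) ≤ p := by exact_mod_cast hp
  -- The pairs (0,2), (0,3), (1,2), (1,3) have i + j + 1 < 6 ≤ p when `t` holds, so their symmetry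
  -- equations are available.
  have ht' : ∀ q, q < 6 → t → q ≠ p := fun q hq h => by have := ht h; omega
  have e03 := H 0 3 2 (by omega) (by omega) (by omega) (ht' _ (by norm_num))
  have e03' := H 0 3 3 (by omega) (by omega) (by omega) (ht' _ (by norm_num))
  have e02 := H 0 2 2 (by omega) (by omega) (by omega) (ht' _ (by norm_num))
  have e02' := H 0 2 3 (by omega) (by omega) (by omega) (ht' _ (by norm_num))
  simp only [hM] at e03 e03' e02 e02'
  norm_num at e03 e03' e02 e02'
  have z0 : c₀ 0 = 0 ∧ c₁ 0 = 0 ∧ c₂ 0 = 0 ∧ μ 0 = 0 :=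
    ⟨e02', by linarith, e03.resolve_right (by linarith), by linarith⟩
  -- Since M 0 j vanishes, symmetry makes M j 0 vanish, which isolates c₀ and μ at index j; `second`
  -- does the same with index 1.
  have first : ∀ j, 1 ≤ j → j < p → (t → j + 1 ≠ p) → c₀ j = 0 ∧ μ j = 0 := by
    intro j hj hjp h
    have h1 := H 0 j 1 (by omega) hjp (by omega) (by simpa using h)
    have h2 := H 0 j 0 (by omega) hjp (by omega) (by simpa using h)
    simp only [hM, z0.1, z0.2.1, z0.2.2.1, z0.2.2.2] at h1 h2
    norm_num at h1 h2
    exact ⟨h1.symm, h2.symm⟩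
  have e13 := H 1 3 3 (by omega) (by omega) (by omega) (ht' _ (by norm_num))
  have e13' := H 1 3 2 (by omega) (by omega) (by omega) (ht' _ (by norm_num))
  simp only [hM, (first 1 (by omega) (by omega) (ht' _ (by norm_num))).2,
    (first 3 (by omega) (by omega) (ht' _ (by norm_num))).1] at e13 e13'
  norm_num at e13 e13'
  have z1 : c₀ 1 = 0 ∧ c₁ 1 = 0 ∧ c₂ 1 = 0 ∧ μ 1 = 0 :=
    ⟨(first 1 (by omega) (by omega) (ht' _ (by norm_num))).1, e13, e13'.resolve_right (by linarith),
      (first 1 (by omega) (by omega) (ht' _ (by norm_num))).2⟩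
  have second : ∀ j, 2 ≤ j → j < p → (t → j + 2 ≠ p) →
      c₀ j = 0 ∧ μ j + c₁ j = 0 ∧ c₂ j = 0 := by
    intro j hj hjp h
    have h0 := H 1 j 2 (by omega) hjp (by omega) (fun ht => by have := h ht; omega)
    have h1 := H 1 j 1 (by omega) hjp (by omega) (fun ht => by have := h ht; omega)
    have h2 := H 1 j 0 (by omega) hjp (by omega) (fun ht => by have := h ht; omega)
    simp only [hM, z1.1, z1.2.1, z1.2.2.1, z1.2.2.2] at h0 h1 h2
    norm_num at h0 h1 h2
    exact ⟨h0.symm, h1.symm, h2.resolve_right (by linarith)⟩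
  have z2 : c₀ 2 = 0 ∧ c₁ 2 = 0 ∧ c₂ 2 = 0 ∧ μ 2 = 0 := by
    obtain ⟨h1, h2⟩ := first 2 (by omega) (by omega) (ht' _ (by norm_num))
    obtain ⟨h3, h4, h5⟩ := second 2 (by omega) (by omega) (ht' _ (by norm_num))
    exact ⟨h1, by linarith, h5, h2⟩
  intro i hi
  obtain rfl | rfl | hi2 : i = 0 ∨ i = 1 ∨ 2 ≤ i := by omega
  · exact z0
  · exact z1
  -- When `t` holds, the indices p - 1 and p - 2 lose their equation with 0 and 1 respectively;
  -- index 2 supplies the replacement.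
  by_cases hl : t ∧ i + 1 = p
  · obtain ⟨h3, h4, h5⟩ := second i hi2 hi (by omega)
    have h := H 2 i 2 (by omega) hi (by omega) (by omega)
    simp only [hM, z2.1, z2.2.1, z2.2.2.1, z2.2.2.2] at h
    norm_num at h
    exact ⟨h3, by linarith, h5, by linarith⟩
  obtain ⟨h1, h2⟩ := first i (by omega) hi (fun h => fun h' => hl ⟨h, h'⟩)
  by_cases hl' : t ∧ i + 2 = p
  · have h := H 2 i 2 (by omega) hi (by omega) (by omega)
    have h' := H 2 i 1 (by omega) hi (by omega) (by omega)
    simp only [hM, z2.1, z2.2.1, z2.2.2.1, z2.2.2.2] at h h'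
    norm_num at h h'
    exact ⟨h1, by linarith, h'.resolve_right (by linarith), h2⟩
  · obtain ⟨h3, h4, h5⟩ := second i hi2 hi (fun h => fun h' => hl' ⟨h, h'⟩)
    exact ⟨h3, by linarith, h5, h2⟩

/-! ### Iterated brackets with N and the structure of u^F. -/

namespace SkewYoungTableau

variable {X : Type u} [AddCommGroup X] [Module ℝ X] {G : GradedSympSpace X}
  {δ : SympFlagSymbol G} {D : SkewYoungDiagram} (T : SkewYoungTableau δ D)

open SkewYoungDiagram

/-- The map `A ↦ [A, N]`, where `N` is the generator of the symbol. -/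
noncomputable def ad : Module.End ℝ (Module.End ℝ X) :=
  LinearMap.mulRight ℝ T.gen - LinearMap.mulLeft ℝ T.gen

lemma ad_apply (A : Module.End ℝ X) : T.ad A = A * T.gen - T.gen * A := rfl

lemma ad_gen : T.ad T.gen = 0 := sub_self _

lemma ad_pow_succ (m : ℕ) (A : Module.End ℝ X) : (T.ad ^ (m + 1)) A = (T.ad ^ m) (T.ad A) := by
  rw [pow_succ, Module.End.mul_apply]

lemma ad_pow_succ' (m : ℕ) (A : Module.End ℝ X) : (T.ad ^ (m + 1)) A = T.ad ((T.ad ^ m) A) := by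
  rw [pow_succ', Module.End.mul_apply]

lemma commute_mul : Commute (LinearMap.mulRight ℝ T.gen) (LinearMap.mulLeft ℝ T.gen) :=
  (LinearMap.commute_mulLeft_right T.gen T.gen).symm

/-- Right multiplication by N is the sum of the commuting operators ad N and left multiplication, so
the binomial theorem applies. -/
lemma mul_gen_pow (A : Module.End ℝ X) (j : ℕ) :
    A * T.gen ^ j = ∑ i ∈ Finset.range (j + 1),
      (j.choose i : ℝ) • (T.gen ^ (j - i) * (T.ad ^ i) A) := by
  have hc : Commute T.ad (LinearMap.mulLeft ℝ T.gen) := T.commute_mul.sub_left (Commute.refl _)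
  have h := hc.add_pow j
  have h1 : T.ad + LinearMap.mulLeft ℝ T.gen = LinearMap.mulRight ℝ T.gen := sub_add_cancel _ _
  rw [h1] at h
  have h2 := LinearMap.congr_fun h A
  rw [LinearMap.pow_mulRight] at h2
  rw [LinearMap.mulRight_apply, LinearMap.sum_apply] at h2
  rw [h2]
  refine Finset.sum_congr rfl fun i _ => ?_
  rw [(hc.pow_pow i (j - i)).eq, LinearMap.pow_mulLeft, Module.End.mul_apply,
    Module.End.mul_apply, Module.End.natCast_apply, map_nsmul, map_nsmul, LinearMap.mulLeft_apply,
    Nat.cast_smul_eq_nsmul]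

lemma ad_pow_apply (A : Module.End ℝ X) (m : ℕ) :
    (T.ad ^ m) A = ∑ i ∈ Finset.range (m + 1),
      ((m.choose i : ℝ) * (-1) ^ i) • (T.gen ^ i * A * T.gen ^ (m - i)) := by
  have hc : Commute (-LinearMap.mulLeft ℝ T.gen) (LinearMap.mulRight ℝ T.gen) :=
    T.commute_mul.symm.neg_left
  have h := hc.add_pow m
  have h1 : -LinearMap.mulLeft ℝ T.gen + LinearMap.mulRight ℝ T.gen = T.ad := by
    rw [ad]; abel
  rw [h1] at h
  rw [h, LinearMap.sum_apply]
  refine Finset.sum_congr rfl fun i _ => ?_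
  rw [neg_pow (LinearMap.mulLeft ℝ T.gen), LinearMap.pow_mulLeft, LinearMap.pow_mulRight, Module.End.mul_apply,
    Module.End.natCast_apply, map_nsmul, Module.End.mul_apply, Module.End.mul_apply,
    LinearMap.mulRight_apply, LinearMap.mulLeft_apply, mul_smul, Nat.cast_smul_eq_nsmul, mul_assoc]
  rcases neg_one_pow_eq_or (Module.End ℝ (Module.End ℝ X)) i with h | h <;>
  rcases Nat.even_or_odd i with h' | h' <;> simp [h'.neg_one_pow]

lemma ad_mem_csp {n : ℤ} {A : Module.End ℝ X} (hA : A ∈ G.csp n) : T.ad A ∈ G.csp (n - 2) := by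
  obtain ⟨⟨c, hc⟩, hA⟩ := hA
  refine ⟨⟨0, fun x y => ?_⟩, fun i x hx => ?_⟩
  · simp only [ad_apply, LinearMap.sub_apply, Module.End.mul_apply, map_sub]
    have h1 := hc (T.gen x) y
    have h2 := hc x (T.gen y)
    rw [T.form_gen] at h1
    rw [T.form_gen x y] at h1
    rw [T.form_gen (A x) y]
    linarith
  · rw [ad_apply, LinearMap.sub_apply, Module.End.mul_apply, Module.End.mul_apply]
    have h1 := hA _ _ (T.gen_mem_csp.2 i x hx)
    have h2 := T.gen_mem_csp.2 _ _ (hA i x hx)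
    have e : i + (n - 2) = i + n + -2 := by ring
    have e' : i + -2 + n = i + n + -2 := by ring
    rw [e]
    rw [e'] at h1
    exact sub_mem h1 h2

lemma mem_flagProlong_zero {A : Module.End ℝ X} (hA : A ∈ δ.flagProlong 0) :
    ∃ c : ℝ, A = c • T.gen := by
  have : A ∈ δ.line := hA
  rw [T.span_gen, Submodule.mem_span_singleton] at this
  obtain ⟨c, hc⟩ := this
  exact ⟨c, hc.symm⟩

lemma mem_flagProlong_one {A : Module.End ℝ X} (hA : A ∈ δ.flagProlong 1) : A = 0 := by
  rw [SympFlagSymbol.flagProlong] at hA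
  exact hA

lemma mem_flagProlong_add_two {n : ℕ} {A : Module.End ℝ X} :
    A ∈ δ.flagProlong (n + 2) ↔ A ∈ G.csp n ∧ T.ad A ∈ δ.flagProlong n := by
  refine ⟨fun h => ⟨h.1, h.2 _ T.gen_mem_line⟩, fun h => ⟨h.1, fun d hd => ?_⟩⟩
  rw [T.span_gen, Submodule.mem_span_singleton] at hd
  obtain ⟨c, rfl⟩ := hd
  rw [lie_smul]
  exact Submodule.smul_mem _ c h.2

lemma ad_pow_mem (k n : ℕ) {A : Module.End ℝ X} (hA : A ∈ δ.flagProlong (n + 2 * k)) :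
    (T.ad ^ k) A ∈ δ.flagProlong n := by
  induction k generalizing A with
  | zero => exact hA
  | succ k ih =>
    rw [ad_pow_succ]
    exact ih (T.mem_flagProlong_add_two.1 hA).2

lemma ad_pow_mem_csp (k n : ℕ) {A : Module.End ℝ X} (hA : A ∈ G.csp n) :
    (T.ad ^ k) A ∈ G.csp (n - 2 * k) := by
  induction k with
  | zero => simpa using hA
  | succ k ih =>
    rw [ad_pow_succ']
    have := T.ad_mem_csp ih
    convert this using 2
    push_cast
    ring

/-- The diagonal blocks of a homogeneous endomorphism `A` of degree `d` with `(ad N)^{d+1} A`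
proportional to `N`. -/
lemma rowCoord_homogeneous {d : ℕ} {A : Module.End ℝ X} (hA : A ∈ G.csp (2 * d : ℕ)) {c : ℝ}
    (hc : (T.ad ^ (d + 1)) A = c • T.gen) {a : D.Row} {j k : ℕ} (hk : k < a.boxes) :
    T.rowCoord a k (A (T.vec a j)) = if k + d = j then
      (j.choose d : ℝ) * T.rowCoord a 0 ((T.ad ^ d) A (T.vec a 0)) + j.choose (d + 1) * c
      else 0 := by
  -- Write v_j = N^j v₀ and move the powers of N to the left of A. The terms with i < d have too
  -- high a weight to meet the row, i = d gives u, i = d + 1 gives c, and later brackets vanish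
  -- because N commutes with itself.
  have h0 : A (T.vec a j) = (A * T.gen ^ j) (T.vec a 0) := by
    rw [Module.End.mul_apply, gen_pow_vec, add_zero]
  rw [h0, mul_gen_pow, LinearMap.sum_apply, map_sum]
  set u := T.rowCoord a 0 ((T.ad ^ d) A (T.vec a 0)) with hu
  have hdeg : ∀ i : ℕ, (T.ad ^ i) A (T.vec a 0) ∈ G.grading (a.left + 2 * ((d : ℤ) - i)) := by
    intro i
    have := (T.ad_pow_mem_csp i _ hA).2 _ _ (T.vec_mem a 0)
    convert this using 2
    push_cast
    ring
  have hterm : ∀ i ∈ Finset.range (j + 1),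
      T.rowCoord a k (((j.choose i : ℝ) • (T.gen ^ (j - i) * (T.ad ^ i) A)) (T.vec a 0)) =
      (if i = d then (if k + d = j then (j.choose d : ℝ) * u else 0) else 0) +
      (if i = d + 1 then (if k + d = j then (j.choose (d + 1) : ℝ) * c else 0) else 0) := by
    intro i hi
    rw [Finset.mem_range] at hi
    rw [LinearMap.smul_apply, map_smul, Module.End.mul_apply, smul_eq_mul,
      T.rowCoord_gen_pow hk]
    obtain h | rfl | rfl | h : i < d ∨ i = d ∨ i = d + 1 ∨ d + 1 < i := by omega
    · rw [if_neg (by omega : i ≠ d), if_neg (by omega : i ≠ d + 1)]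
      split_ifs with h'
      · rw [T.rowCoord_eq_zero _ (hdeg i)]
        · simp
        · omega
      · simp
    · rw [if_pos rfl, if_neg (by omega : i ≠ i + 1), add_zero]
      by_cases h' : k + i = j
      · rw [if_pos (by omega), if_pos h']
        have : k - (j - i) = 0 := by omega
        rw [this]
      · rw [if_neg h']
        split_ifs
        · rw [T.rowCoord_eq_zero _ (hdeg i), mul_zero]
          omega
        · simp
    · rw [if_neg (by omega : d + 1 ≠ d), if_pos rfl, zero_add, hc, LinearMap.smul_apply,
        gen_vec, map_smul, T.rowCoord_vec (by omega)]
      by_cases h' : k + d = j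
      · rw [if_pos (by omega), if_pos h', if_pos (by omega)]
        simp
      · rw [if_neg h']
        split_ifs
        · omega
        · simp
        · simp
    · rw [if_neg (by omega : i ≠ d), if_neg (by omega : i ≠ d + 1)]
      obtain ⟨q, rfl⟩ : ∃ q, i = (q + 1) + (d + 1) := ⟨i - d - 2, by omega⟩
      rw [pow_add, Module.End.mul_apply, hc, map_smul, ad_pow_succ, ad_gen]
      simp
  rw [Finset.sum_congr rfl hterm, Finset.sum_add_distrib, Finset.sum_ite_eq', Finset.sum_ite_eq']
  simp only [Finset.mem_range]
  by_cases h : k + d = j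
  · have hd : d < j + 1 := by omega
    simp only [if_pos h, if_pos hd]
    split_ifs with h'
    · rfl
    · have : j.choose (d + 1) = 0 := Nat.choose_eq_zero_of_lt (by omega)
      simp [this]
  · simp [if_neg h]

/-- In degrees greater than one the obstruction `c` vanishes together with the diagonal blocks. -/
lemma homogeneous_eq_zero {d : ℕ} (hd : 2 ≤ d) {A : Module.End ℝ X}
    (hA : A ∈ G.csp (2 * d : ℕ)) {c : ℝ} (hc : (T.ad ^ (d + 1)) A = c • T.gen) {a : D.Row}
    (ha : 2 ≤ a.boxes) :
    T.rowCoord a 0 ((T.ad ^ d) A (T.vec a 0)) = 0 ∧ c = 0 := by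
  -- Beyond the end of the row v_j = 0, so the formula for the coordinates becomes a linear relation
  -- between u and c.
  have key : ∀ j k, k < a.boxes → a.boxes ≤ j → k + d = j →
      (j.choose d : ℝ) * T.rowCoord a 0 ((T.ad ^ d) A (T.vec a 0)) + j.choose (d + 1) * c = 0 := by
    intro j k hk hj hkj
    have := T.rowCoord_homogeneous hA hc (j := j) hk
    rw [if_pos hkj, T.vec_eq_zero hj, map_zero, map_zero] at this
    exact this.symm
  set u := T.rowCoord a 0 ((T.ad ^ d) A (T.vec a 0)) with hu
  by_cases h : a.boxes ≤ d
  · have h1 := key d 0 (by omega) h (by omega)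
    have h2 := key (d + 1) 1 (by omega) (by omega) (by omega)
    simp at h1 h2
    rw [h1] at h2
    exact ⟨h1, by linarith⟩
  · obtain ⟨q, hq⟩ : ∃ q, a.boxes = d + q := ⟨a.boxes - d, by omega⟩
    -- Since d ≥ 2, both j = p and j = p + 1 give relations, p being the row length. After removal
    -- of binomial factors they differ exactly by c.
    have h1 := key (d + q) q (by omega) (by omega) (by omega)
    have h2 := key (d + q + 1) (q + 1) (by omega) (by omega) (by omega)
    have e1 : ((d + q).choose (d + 1) : ℝ) * (d + 1) = (d + q).choose d * q := by
      have := Nat.choose_succ_right_eq (d + q) d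
      rw [Nat.add_sub_cancel_left] at this
      exact_mod_cast this
    have e2 : ((d + q + 1).choose (d + 1) : ℝ) * (d + 1) = (d + q + 1) * (d + q).choose d := by
      have := Nat.add_one_mul_choose_eq (d + q) d
      exact_mod_cast this.symm
    have e3 : ((d + q + 1).choose d : ℝ) * (q + 1) = (d + q + 1).choose (d + 1) * (d + 1) := by
      have := Nat.choose_succ_right_eq (d + q + 1) d
      rw [show d + q + 1 - d = q + 1 by omega] at this
      exact_mod_cast this.symm
    have hpos : (0 : ℝ) < (d + q).choose d := by
      exact_mod_cast Nat.choose_pos (by omega)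
    have hdR : (0 : ℝ) ≤ d := by positivity
    have hqR : (0 : ℝ) ≤ q := by positivity
    have f1 : (d + 1) * u + q * c = 0 := by
      have : ((d + q).choose d : ℝ) * ((d + 1) * u + q * c) = 0 := by
        linear_combination (d + 1 : ℝ) * h1 - c * e1
      exact (mul_eq_zero.1 this).resolve_left hpos.ne'
    have f2 : (d + 1) * u + (q + 1) * c = 0 := by
      have h3 : ((d + q + 1).choose (d + 1) : ℝ) * ((d + 1) * u + (q + 1) * c) = 0 := by
        linear_combination (q + 1 : ℝ) * h2 - u * e3
      have hpos' : (0 : ℝ) < (d + q + 1).choose (d + 1) := by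
        exact_mod_cast Nat.choose_pos (by omega)
      exact (mul_eq_zero.1 h3).resolve_left hpos'.ne'
    have hc0 : c = 0 := by linarith
    refine ⟨?_, hc0⟩
    rw [hc0, mul_zero, add_zero] at f1
    exact (mul_eq_zero.1 f1).resolve_left (by linarith)

/-- The structure of the universal prolongation of the symbol: modulo the endomorphisms all whose
iterated brackets with `N` preserve the filtration, an element of it is determined by the multiples
`c m` of `N` in its iterated brackets; and its diagonal blocks belong to `gl₂`. -/
def HasCoefficients (A : Module.End ℝ X) (c : ℕ → ℝ) : Prop :=
  (∀ m, (T.ad ^ m) A - c m • T.gen ∈ G.filtrationPreserving) ∧ (∀ m, 3 ≤ m → c m = 0) ∧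
  ∀ a : D.Row, ∃ μ : ℝ, ∀ j k, j < a.boxes → k < a.boxes →
    T.rowCoord a k (A (T.vec a j)) = (if k = j + 1 then c 0 else 0) +
      (if k = j then μ + c 1 * j else 0) +
      (if k + 1 = j then c 2 / 2 * (j * ((j : ℝ) - a.boxes)) else 0)

lemma HasCoefficients.add {A B : Module.End ℝ X} {c d : ℕ → ℝ} (hA : T.HasCoefficients A c)
    (hB : T.HasCoefficients B d) : T.HasCoefficients (A + B) (c + d) := by
  refine ⟨fun m => ?_, fun m hm => ?_, fun a => ?_⟩
  · convert add_mem (hA.1 m) (hB.1 m) using 1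
    simp only [map_add, Pi.add_apply, add_smul]; abel
  · rw [Pi.add_apply, hA.2.1 m hm, hB.2.1 m hm, add_zero]
  · obtain ⟨μ, hμ⟩ := hA.2.2 a
    obtain ⟨ν, hν⟩ := hB.2.2 a
    refine ⟨μ + ν, fun j k hj hk => ?_⟩
    rw [LinearMap.add_apply, map_add, hμ j k hj hk, hν j k hj hk]
    simp only [Pi.add_apply]
    split_ifs <;> ring

lemma hasCoefficients_zero : T.HasCoefficients 0 0 :=
  ⟨fun m => by simp, fun _ _ => rfl, fun a => ⟨0, fun j k _ _ => by simp⟩⟩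

lemma hasCoefficients_even {d : ℕ} {A : Module.End ℝ X} (hA : A ∈ G.csp (2 * d : ℕ))
    {e : ℝ} (he : (T.ad ^ (d + 1)) A = e • T.gen) (h2 : ∀ a : D.Row, 2 ≤ a.boxes) :
    T.HasCoefficients A (fun m => if m = d + 1 then e else 0) := by
  refine ⟨fun m => ?_, fun m hm => ?_, fun a => ?_⟩
  · dsimp only
    obtain h | rfl | h : m ≤ d ∨ m = d + 1 ∨ d + 1 < m := by omega
    · rw [if_neg (by omega), zero_smul, sub_zero]
      exact G.csp_le_filtrationPreserving (by push_cast; omega) (T.ad_pow_mem_csp m _ hA)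
    · rw [if_pos rfl, he, sub_self]; exact zero_mem _
    · rw [if_neg (by omega), zero_smul, sub_zero]
      obtain ⟨q, rfl⟩ : ∃ q, m = (q + 1) + (d + 1) := ⟨m - d - 2, by omega⟩
      rw [pow_add, Module.End.mul_apply, he, map_smul, ad_pow_succ, ad_gen]
      simp
  · dsimp only
    split_ifs with h
    · obtain ⟨a⟩ := T.nonempty_row
      exact (T.homogeneous_eq_zero (by omega) hA he (h2 a)).2
    · rfl
  · have hcoord := fun j k (hk : k < a.boxes) => T.rowCoord_homogeneous hA he (a := a) (j := j) hk
    set u := T.rowCoord a 0 ((T.ad ^ d) A (T.vec a 0)) with hu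
    obtain rfl | rfl | hd : d = 0 ∨ d = 1 ∨ 2 ≤ d := by omega
    · refine ⟨u, fun j k hj hk => ?_⟩
      rw [hcoord j k hk]
      simp only [add_zero, zero_add, Nat.choose_zero_right, Nat.choose_one_right]
      norm_num
      split_ifs <;> ring
    · have hu0 : u = -((a.boxes : ℝ) - 1) / 2 * e := by
        have h := hcoord a.boxes (a.boxes - 1) (by have := h2 a; omega)
        rw [T.vec_eq_zero le_rfl, map_zero, map_zero, if_pos (by have := h2 a; omega),
          Nat.choose_one_right, Nat.cast_choose_two] at h
        have hp : (a.boxes : ℝ) ≠ 0 := by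
          have := a.boxes_pos
          positivity
        have : (a.boxes : ℝ) * (u + ((a.boxes : ℝ) - 1) / 2 * e) = 0 := by linarith
        have := (mul_eq_zero.1 this).resolve_left hp
        linarith
      refine ⟨0, fun j k hj hk => ?_⟩
      rw [hcoord j k hk, hu0]
      simp only [Nat.choose_one_right, one_add_one_eq_two, Nat.cast_choose_two]
      norm_num
      split_ifs <;> ring
    · obtain ⟨h0, h1⟩ := T.homogeneous_eq_zero hd hA he (h2 a)
      refine ⟨0, fun j k hj hk => ?_⟩
      rw [hcoord j k hk, h1, hu, h0]
      simp

/-- Weights within a row differ by integers, so an operator of half-integral degree has zero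
diagonal blocks. -/
lemma hasCoefficients_odd {d : ℕ} {A : Module.End ℝ X} (hA : A ∈ G.csp (2 * d + 1 : ℕ))
    (he : (T.ad ^ (d + 1)) A = 0) : T.HasCoefficients A 0 := by
  refine ⟨fun m => ?_, fun _ _ => rfl, fun a => ⟨0, fun j k hj hk => ?_⟩⟩
  · rw [Pi.zero_apply, zero_smul, sub_zero]
    by_cases h : m ≤ d
    · exact G.csp_le_filtrationPreserving (by push_cast; omega) (T.ad_pow_mem_csp m _ hA)
    · obtain ⟨q, rfl⟩ : ∃ q, m = q + (d + 1) := ⟨m - d - 1, by omega⟩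
      rw [pow_add, Module.End.mul_apply, he, map_zero]
      exact zero_mem _
  · rw [T.rowCoord_eq_zero _ (hA.2 _ _ (T.vec_mem a j))]
    · simp
    · push_cast; omega

lemma exists_hasCoefficients (h2 : ∀ a : D.Row, 2 ≤ a.boxes) {A : Module.End ℝ X}
    (hA : A ∈ δ.uF) : ∃ c, T.HasCoefficients A c := by
  refine Submodule.iSup_induction _ (motive := fun A => ∃ c, T.HasCoefficients A c) hA
    (fun n A hA => ?_) ⟨0, T.hasCoefficients_zero⟩
    fun A B ⟨c, hc⟩ ⟨d, hd⟩ => ⟨c + d, HasCoefficients.add T hc hd⟩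
  match n, hA with
  | 0, hA =>
    obtain ⟨c, rfl⟩ := T.mem_flagProlong_zero hA
    refine ⟨fun m => if m = 0 then c else 0, fun m => ?_, fun m hm => if_neg (by omega), fun a => ⟨0, fun j k _ hk => ?_⟩⟩
    · cases m with
      | zero => simp
      | succ m => rw [ad_pow_succ, map_smul, ad_gen]; simp
    · rw [LinearMap.smul_apply, map_smul, gen_vec, T.rowCoord_vec hk]
      simp
  | 1, hA =>
    rw [mem_flagProlong_one hA]
    exact ⟨0, T.hasCoefficients_zero⟩
  | n + 2, hA =>
    have hcsp := (T.mem_flagProlong_add_two.1 hA).1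
    obtain ⟨d, rfl | rfl⟩ := Nat.even_or_odd' n
    · have h := T.ad_pow_mem (d + 1) 0 (by rw [show 0 + 2 * (d + 1) = 2 * d + 2 by ring]; exact hA)
      obtain ⟨c, hc⟩ := T.mem_flagProlong_zero h
      exact ⟨_, T.hasCoefficients_even hcsp hc h2⟩
    · have h := T.ad_pow_mem (d + 1) 1
        (by rw [show 1 + 2 * (d + 1) = 2 * d + 1 + 2 by ring]; exact hA)
      exact ⟨0, T.hasCoefficients_odd hcsp (mem_flagProlong_one h)⟩

end SkewYoungTableau

/-! ### The algebra 𝔩(X) through iterated brackets, and its inclusion in u^F. -/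

lemma nilExp_eq_sum {X : Type u} [AddCommGroup X] [Module ℝ X] {x : Module.End ℝ X} {k : ℕ}
    (h : x ^ k = 0) : nilExp x = ∑ i ∈ Finset.range k, ((i.factorial : ℝ)⁻¹) • x ^ i := by
  have hk : nilpotencyClass x ≤ k := csInf_le' h
  rw [nilExp, ← Finset.sum_range_add_sum_Ico _ hk, left_eq_add]
  refine Finset.sum_eq_zero fun i hi => ?_
  rw [pow_eq_zero_of_le (Finset.mem_Ico.1 hi).1 (pow_nilpotencyClass ⟨k, h⟩), smul_zero]

lemma isUnit_nilExp {X : Type u} [AddCommGroup X] [Module ℝ X] {x : Module.End ℝ X}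
    (h : IsNilpotent x) : IsUnit (nilExp x) := by
  obtain ⟨k, hk⟩ := h
  rw [nilExp_eq_sum (pow_eq_zero_of_le k.le_succ hk), Finset.sum_range_succ']
  simp only [Nat.factorial_zero, Nat.cast_one, inv_one, pow_zero, one_smul]
  refine IsNilpotent.isUnit_add_one ?_
  refine Commute.isNilpotent_sum (fun i _ => ?_) fun i j _ _ => ?_
  · exact (IsNilpotent.pow_of_pos ⟨k, hk⟩ i.succ_ne_zero).smul _
  · exact ((Commute.refl x).pow_pow _ _).smul_left _ |>.smul_right _

namespace SkewYoungTableau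

variable {X : Type u} [AddCommGroup X] [Module ℝ X] {G : GradedSympSpace X}
  {δ : SympFlagSymbol G} {D : SkewYoungDiagram} (T : SkewYoungTableau δ D)

open SkewYoungDiagram

lemma finite_box [FiniteDimensional ℝ X] (T : SkewYoungTableau δ D) : Finite D.Box :=
  Module.Finite.finite_basis T.basis

lemma isNilpotent_gen [FiniteDimensional ℝ X] : IsNilpotent T.gen := by
  have := T.finite_box
  obtain ⟨K, hK⟩ := (Set.finite_range fun b : D.Box => b.1.boxes).bddAbove
  refine ⟨K, T.basis.ext fun b => ?_⟩
  obtain ⟨a, j, hj⟩ := b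
  rw [← T.vec_eq_basis hj, gen_pow_vec, T.vec_eq_zero, LinearMap.zero_apply]
  have := hK ⟨⟨a, j, hj⟩, rfl⟩
  simp only at this
  omega

lemma ad_pow_eq_zero {K : ℕ} (hK : T.gen ^ K = 0) {m : ℕ} (hm : 2 * K ≤ m)
    (A : Module.End ℝ X) : (T.ad ^ m) A = 0 := by
  rw [ad_pow_apply]
  refine Finset.sum_eq_zero fun i _ => ?_
  by_cases h : K ≤ i
  · rw [pow_eq_zero_of_le h hK]; simp
  · rw [pow_eq_zero_of_le (show K ≤ m - i by omega) hK]; simp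

lemma nilExp_smul_gen {K : ℕ} (hK : T.gen ^ K = 0) (t : ℝ) : nilExp (t • T.gen) =
    ∑ i ∈ Finset.range K, (t ^ i * (i.factorial : ℝ)⁻¹) • T.gen ^ i := by
  rw [nilExp_eq_sum (k := K) (by rw [smul_pow, hK, smul_zero])]
  refine Finset.sum_congr rfl fun i _ => ?_
  rw [smul_pow, smul_smul, mul_comm]

/-- `A e^{tN} = e^{tN} ∑ t^m / m! (ad N)^m A`. -/
lemma mul_nilExp {K : ℕ} (hK : T.gen ^ K = 0) (A : Module.End ℝ X) (t : ℝ) :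
    A * nilExp (t • T.gen) = nilExp (t • T.gen) *
      ∑ m ∈ Finset.range (3 * K), (t ^ m * (m.factorial : ℝ)⁻¹) • (T.ad ^ m) A := by
  have hK3 : T.gen ^ (3 * K) = 0 := pow_eq_zero_of_le (by omega) hK
  rw [T.nilExp_smul_gen hK3, Finset.mul_sum, Finset.sum_mul_sum, Finset.sum_comm]
  let f : ℕ → ℕ → Module.End ℝ X := fun i l =>
    (t ^ l * (l.factorial : ℝ)⁻¹) • T.gen ^ l * (t ^ i * (i.factorial : ℝ)⁻¹) • (T.ad ^ i) A
  have h1 : ∀ j ∈ Finset.range (3 * K), A * (t ^ j * (j.factorial : ℝ)⁻¹) • T.gen ^ j =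
      ∑ i ∈ Finset.range (j + 1), f i (j - i) := by
    intro j _
    rw [mul_smul_comm, mul_gen_pow, Finset.smul_sum]
    refine Finset.sum_congr rfl fun i hi => ?_
    have hij : i ≤ j := Nat.lt_succ_iff.1 (Finset.mem_range.1 hi)
    simp only [f]
    rw [smul_mul_smul_comm, smul_smul]
    congr 1
    rw [Nat.cast_choose ℝ hij]
    have : t ^ j = t ^ (j - i) * t ^ i := by rw [← pow_add, Nat.sub_add_cancel hij]
    rw [this]
    have := Nat.factorial_ne_zero j
    field_simp
  rw [Finset.sum_congr rfl h1, Finset.sum_range_diag_flip]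
  refine Finset.sum_congr rfl fun i hi => ?_
  -- The triangle and the square of indices differ only where l + i ≥ 3K; there l ≥ K or i ≥ 2K, so
  -- the term is zero.
  refine Finset.sum_subset (Finset.range_mono (Nat.sub_le _ _)) fun l _ hl => ?_
  rw [Finset.mem_range] at hi hl
  simp only [f]
  by_cases h : K ≤ l
  · rw [pow_eq_zero_of_le h hK]; simp
  · rw [T.ad_pow_eq_zero hK (m := i) (by omega)]; simp

/-- The infinitesimal symmetries of the flat curve are the skew endomorphisms all whose iterated
brackets with the generator of the symbol preserve the filtration. -/
lemma mem_lX_iff [FiniteDimensional ℝ X] {A : Module.End ℝ X} :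
    A ∈ δ.lX ↔ (∀ x y, G.form (A x) y = -G.form x (A y)) ∧
      ∀ m, (T.ad ^ m) A ∈ G.filtrationPreserving := by
  obtain ⟨K, hK⟩ := T.isNilpotent_gen
  have hskew : A ∈ skewAdjointLieSubalgebra G.form ↔
      ∀ x y, G.form (A x) y = -G.form x (A y) := by
    refine (LinearMap.mem_skewAdjointSubmodule _).trans ?_
    simp [LinearMap.IsSkewAdjoint, LinearMap.IsAdjointPair]
  have hlX : A ∈ δ.lX ↔ A ∈ skewAdjointLieSubalgebra G.form ∧
    ∀ (x : δ.line) (i : ℤ), ∀ y ∈ δ.flatCurve x i, A y ∈ δ.flatCurve x i := Iff.rfl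
  rw [hlX, hskew]
  refine and_congr_right fun _ => ⟨fun h => ?_, fun h => ?_⟩
  · have hS : ∀ t : ℝ, ∑ m ∈ Finset.range (3 * K), (t ^ m * (m.factorial : ℝ)⁻¹) • (T.ad ^ m) A
        ∈ G.filtrationPreserving := by
      intro t i y hy
      have h1 := h ⟨t • T.gen, Submodule.smul_mem _ t T.gen_mem_line⟩ i
        (nilExp (t • T.gen) y) ⟨y, hy, rfl⟩
      obtain ⟨z, hz, hzy⟩ := h1
      have h2 := LinearMap.congr_fun (T.mul_nilExp hK A t) y
      rw [Module.End.mul_apply, ← hzy, Module.End.mul_apply] at h2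
      have hinj := ((Module.End.isUnit_iff _).1 (isUnit_nilExp (x := t • T.gen)
        ⟨K, by rw [smul_pow, hK, smul_zero]⟩)).injective
      rw [← hinj h2]
      exact hz
    intro m
    by_contra hm
    -- A functional killing the filtration-preserving maps but not (ad N)^m A turns the expansion in
    -- t into a polynomial that vanishes at every real t; its m-th coefficient is then zero.
    obtain ⟨φ, hφ, hker⟩ := Submodule.exists_le_ker_of_notMem hm
    let p : Polynomial ℝ := ∑ k ∈ Finset.range (3 * K),
      Polynomial.monomial k ((k.factorial : ℝ)⁻¹ * φ ((T.ad ^ k) A))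
    have hp : p = 0 := by
      refine Polynomial.funext fun t => ?_
      have : φ _ = 0 := hker (hS t)
      rw [map_sum] at this
      simp only [p, Polynomial.eval_finsetSum, Polynomial.eval_monomial, Polynomial.eval_zero]
      rw [← this]
      refine Finset.sum_congr rfl fun k _ => ?_
      rw [map_smul, smul_eq_mul]; ring
    have hc : p.coeff m = 0 := by rw [hp, Polynomial.coeff_zero]
    simp only [p, Polynomial.finsetSum_coeff, Polynomial.coeff_monomial] at hc
    rw [Finset.sum_ite_eq' (Finset.range (3 * K)) m] at hc
    split_ifs at hc with hmK
    · have : ((m.factorial : ℝ)⁻¹) ≠ 0 := by positivity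
      exact hφ ((mul_eq_zero.1 hc).resolve_left this)
    · rw [T.ad_pow_eq_zero hK (by rw [Finset.mem_range] at hmK; omega), map_zero] at hφ
      exact hφ rfl
  · rintro ⟨x, hx⟩ i _ ⟨z, hz, rfl⟩
    rw [T.span_gen, Submodule.mem_span_singleton] at hx
    obtain ⟨t, rfl⟩ := hx
    have h2 := LinearMap.congr_fun (T.mul_nilExp hK A t) z
    rw [Module.End.mul_apply, Module.End.mul_apply] at h2
    dsimp only
    rw [h2]
    refine ⟨_, ?_, rfl⟩
    exact (sum_mem fun m _ => Submodule.smul_mem _ _ (h m) : _ ∈ G.filtrationPreserving) i z hz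

/-- The projection onto a graded component. -/
noncomputable def proj (i : ℤ) : Module.End ℝ X :=
  T.basis.constr ℝ fun b => if Box.weight b = i then T.basis b else 0

lemma proj_basis (i : ℤ) (b : D.Box) :
    T.proj i (T.basis b) = if Box.weight b = i then T.basis b else 0 :=
  T.basis.constr_basis ℝ _ b

lemma mem_span_of_mem_grading {i : ℤ} {x : X} (hx : x ∈ G.grading i) :
    x ∈ Submodule.span ℝ (T.basis '' {b | Box.weight b = i}) := by
  rw [T.basis.mem_span_image]
  intro b hb
  by_contra h
  exact (Finsupp.mem_support_iff.1 hb) (T.coord_eq_zero h hx)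

lemma eqOn_grading {Y : Type*} [AddCommGroup Y] [Module ℝ Y] {f g : X →ₗ[ℝ] Y} {i : ℤ}
    (h : ∀ b : D.Box, Box.weight b = i → f (T.basis b) = g (T.basis b)) {x : X}
    (hx : x ∈ G.grading i) : f x = g x := by
  refine LinearMap.eqOn_span ?_ (T.mem_span_of_mem_grading hx)
  rintro _ ⟨b, hb, rfl⟩
  exact h b hb

lemma proj_of_mem_self {i : ℤ} {x : X} (hx : x ∈ G.grading i) : T.proj i x = x :=
  T.eqOn_grading (g := LinearMap.id) (fun b hb => by rw [proj_basis, if_pos hb]; rfl) hx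

lemma proj_of_mem_ne {i j : ℤ} (h : j ≠ i) {x : X} (hx : x ∈ G.grading j) : T.proj i x = 0 :=
  T.eqOn_grading (g := 0) (fun b hb => by rw [proj_basis, if_neg (hb.trans_ne h)]; rfl) hx

lemma proj_mem (i : ℤ) (x : X) : T.proj i x ∈ G.grading i := by
  have : Submodule.span ℝ (Set.range T.basis) ≤ (G.grading i).comap (T.proj i) := by
    rw [Submodule.span_le]
    rintro _ ⟨b, rfl⟩
    rw [SetLike.mem_coe, Submodule.mem_comap, proj_basis]
    split_ifs with h
    · rw [← h]; exact T.basis_mem b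
    · exact zero_mem _
  exact this (T.basis.mem_span x)

lemma form_proj (i : ℤ) (x : X) {j : ℤ} {y : X} (hy : y ∈ G.grading j) :
    G.form (T.proj i x) y = if i + j = 0 then G.form x y else 0 := by
  have : G.form.flip y ∘ₗ T.proj i = (if i + j = 0 then (1 : ℝ) else 0) • G.form.flip y := by
    refine T.basis.ext fun b => ?_
    rw [LinearMap.comp_apply, proj_basis, LinearMap.smul_apply]
    by_cases h1 : Box.weight b = i
    · rw [if_pos h1]
      by_cases h2 : i + j = 0
      · rw [if_pos h2, one_smul]
      · rw [if_neg h2, zero_smul, LinearMap.BilinForm.flip_apply,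
          G.form_eq_zero i j h2 _ (h1 ▸ T.basis_mem b) _ hy]
    · rw [if_neg h1, map_zero]
      by_cases h2 : i + j = 0
      · rw [LinearMap.BilinForm.flip_apply,
          G.form_eq_zero _ j (by omega) _ (T.basis_mem b) _ hy, smul_zero]
      · rw [if_neg h2, zero_smul]
  have := LinearMap.congr_fun this x
  rw [LinearMap.comp_apply, LinearMap.BilinForm.flip_apply, LinearMap.smul_apply,
    LinearMap.BilinForm.flip_apply] at this
  rw [this]
  split_ifs <;> simp

lemma gen_proj (i : ℤ) (x : X) : T.gen (T.proj i x) = T.proj (i - 2) (T.gen x) := by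
  have : T.gen ∘ₗ T.proj i = T.proj (i - 2) ∘ₗ T.gen := by
    refine T.basis.ext fun b => ?_
    have hb := T.gen_mem_csp.2 _ _ (T.basis_mem b)
    rw [LinearMap.comp_apply, LinearMap.comp_apply, proj_basis]
    split_ifs with h
    · rw [T.proj_of_mem_self]
      rw [h] at hb
      exact hb
    · rw [T.proj_of_mem_ne _ hb, map_zero]
      omega
  exact LinearMap.congr_fun this x

/-- The homogeneous component of degree `k / 2` of an endomorphism. -/
noncomputable def component (k : ℤ) (A : Module.End ℝ X) : Module.End ℝ X :=
  T.basis.constr ℝ fun b => T.proj (Box.weight b + k) (A (T.basis b))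

lemma component_basis (k : ℤ) (A : Module.End ℝ X) (b : D.Box) :
    T.component k A (T.basis b) = T.proj (Box.weight b + k) (A (T.basis b)) :=
  T.basis.constr_basis ℝ _ b

lemma component_of_mem (k : ℤ) (A : Module.End ℝ X) {i : ℤ} {x : X} (hx : x ∈ G.grading i) :
    T.component k A x = T.proj (i + k) (A x) :=
  T.eqOn_grading (g := T.proj (i + k) ∘ₗ A)
    (fun b hb => by rw [component_basis, hb]; rfl) hx

lemma ad_component (k : ℤ) (A : Module.End ℝ X) :
    T.ad (T.component k A) = T.component (k - 2) (T.ad A) := by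
  refine T.basis.ext fun b => ?_
  rw [component_basis, ad_apply, ad_apply, LinearMap.sub_apply, LinearMap.sub_apply, map_sub,
    Module.End.mul_apply, Module.End.mul_apply, Module.End.mul_apply, Module.End.mul_apply,
    component_basis, gen_proj, T.component_of_mem k A (T.gen_mem_csp.2 _ _ (T.basis_mem b))]
  congr 3 <;> ring

/-- The projections to weights i and -i are adjoint for the form, so taking a homogeneous component
preserves skewness. -/
lemma component_skew (k : ℤ) {A : Module.End ℝ X} (hA : ∀ x y, G.form (A x) y = -G.form x (A y))
    (x y : X) : G.form (T.component k A x) y = -G.form x (T.component k A y) := by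
  have : G.form ∘ₗ T.component k A = -G.form.compl₂ (T.component k A) := by
    refine T.basis.ext fun b => T.basis.ext fun b' => ?_
    simp only [LinearMap.comp_apply, LinearMap.neg_apply, LinearMap.compl₂_apply, component_basis]
    rw [T.form_proj _ _ (T.basis_mem b'), G.form_swap (T.basis b),
      T.form_proj _ _ (T.basis_mem b), hA, G.form_swap (T.basis b)]
    split_ifs <;> first | omega | simp
  have := LinearMap.congr_fun (LinearMap.congr_fun this x) y
  simpa using this

lemma component_eq_zero {k : ℤ} (hk : k < 0) {A : Module.End ℝ X}
    (hA : A ∈ G.filtrationPreserving) : T.component k A = 0 := by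
  refine T.basis.ext fun b => ?_
  rw [component_basis, LinearMap.zero_apply]
  have h : G.filtration (Box.weight b) ≤ LinearMap.ker (T.proj (Box.weight b + k)) :=
    iSup₂_le fun j hj y hy => T.proj_of_mem_ne (by omega) hy
  exact h (hA _ _ (G.grading_le_filtration le_rfl (T.basis_mem b)))

/-- Bracketing with N lowers the degree of a component by one. In degrees 0 and 1/2 the bracket is a
component of negative degree of a filtration-preserving map, hence zero; higher degrees follow by
induction. -/
lemma component_mem_flagProlong (n : ℕ) : ∀ A : Module.End ℝ X,
    (∀ x y, G.form (A x) y = -G.form x (A y)) →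
    (∀ m, (T.ad ^ m) A ∈ G.filtrationPreserving) →
    T.component n A ∈ δ.flagProlong (n + 2) := by
  induction n using Nat.twoStepInduction with
  | zero =>
    intro A hs hA
    refine T.mem_flagProlong_add_two.2 ⟨⟨⟨0, fun x y => ?_⟩, fun i x hx => ?_⟩, ?_⟩
    · rw [T.component_skew _ hs]; ring
    · rw [T.component_of_mem _ A hx]; exact T.proj_mem _ _
    · have h : T.component (((0 : ℕ) : ℤ) - 2) (T.ad A) = 0 :=
        T.component_eq_zero (by norm_num) (by simpa using hA 1)
      rw [ad_component, h]
      exact zero_mem _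
  | one =>
    intro A hs hA
    refine T.mem_flagProlong_add_two.2 ⟨⟨⟨0, fun x y => ?_⟩, fun i x hx => ?_⟩, ?_⟩
    · rw [T.component_skew _ hs]; ring
    · rw [T.component_of_mem _ A hx]; exact T.proj_mem _ _
    · have h : T.component (((1 : ℕ) : ℤ) - 2) (T.ad A) = 0 :=
        T.component_eq_zero (by norm_num) (by simpa using hA 1)
      rw [ad_component, h]
      exact zero_mem _
  | more n ih _ =>
    intro A hs hA
    refine T.mem_flagProlong_add_two.2 ⟨⟨⟨0, fun x y => ?_⟩, fun i x hx => ?_⟩, ?_⟩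
    · rw [T.component_skew _ hs]; ring
    · rw [T.component_of_mem _ A hx]; exact T.proj_mem _ _
    · rw [ad_component, show ((n + 2 : ℕ) : ℤ) - 2 = n by push_cast; ring]
      refine ih _ (fun x y => ?_) fun m => ?_
      · simp only [ad_apply, LinearMap.sub_apply, Module.End.mul_apply, map_sub, hs, T.form_gen]
        ring
      · rw [← ad_pow_succ]; exact hA _

/-- Only differences of weights of boxes occur as degrees, and there are finitely many. -/
lemma sum_component [FiniteDimensional ℝ X] (T : SkewYoungTableau δ D) :
    ∃ S : Finset ℤ, ∀ A : Module.End ℝ X, ∑ k ∈ S, T.component k A = A := by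
  have := T.finite_box
  refine ⟨(Set.finite_range fun q : D.Box × D.Box =>
    Box.weight q.1 - Box.weight q.2).toFinset, fun A => T.basis.ext fun b => ?_⟩
  set S := (Set.finite_range fun q : D.Box × D.Box =>
    Box.weight q.1 - Box.weight q.2).toFinset
  have : ∑ k ∈ S, T.proj (Box.weight b + k) = 1 := by
    refine T.basis.ext fun b' => ?_
    rw [LinearMap.sum_apply, Finset.sum_eq_single (Box.weight b' - Box.weight b)]
    · rw [proj_basis, if_pos (by ring)]; rfl
    · intro k _ hk
      rw [proj_basis, if_neg (by omega)]
    · intro h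
      refine absurd ((Set.Finite.mem_toFinset _).2 ?_) h
      exact ⟨(b', b), rfl⟩
  have h := LinearMap.congr_fun this (A (T.basis b))
  rw [LinearMap.sum_apply, Module.End.one_apply] at h
  rw [LinearMap.sum_apply]
  simpa only [component_basis] using h

/-- The infinitesimal symmetries of the flat curve belong to the universal prolongation. -/
lemma lX_le_uF [FiniteDimensional ℝ X] (T : SkewYoungTableau δ D) :
    δ.lX.toSubmodule ≤ δ.uF := by
  intro A hA
  obtain ⟨hs, hA⟩ := T.mem_lX_iff.1 hA
  obtain ⟨S, hS⟩ := T.sum_component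
  rw [← hS A]
  refine sum_mem fun k _ => ?_
  by_cases hk : k < 0
  · rw [T.component_eq_zero hk (by simpa using hA 0)]; exact zero_mem _
  · obtain ⟨n, rfl⟩ := Int.eq_ofNat_of_zero_le (not_lt.1 hk)
    exact (le_iSup δ.flagProlong (n + 2)) (T.component_mem_flagProlong n A hs hA)

end SkewYoungTableau

/-! ### The first Tanaka prolongation. -/

namespace SkewYoungTableau

variable {X : Type u} [AddCommGroup X] [Module ℝ X] {G : GradedSympSpace X}
  {δ : SympFlagSymbol G} {D : SkewYoungDiagram} (T : SkewYoungTableau δ D)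

open SkewYoungDiagram

lemma form_vec_vec {a : D.Row} {i j : ℕ} (hi : i < a.boxes) (hj : j < a.boxes)
    (h : ¬ a.IsIntegral → i + j + 1 ≠ a.boxes) : G.form (T.vec a i) (T.vec a j) = 0 := by
  rw [T.vec_eq_basis hi, T.vec_eq_basis hj, T.form_basis, pairing_row a _ _ h, mul_zero]

lemma ext_vec {Y : Type*} [AddCommGroup Y] [Module ℝ Y] {f g : X →ₗ[ℝ] Y}
    (h : ∀ (a : D.Row) (j : ℕ), j < a.boxes → f (T.vec a j) = g (T.vec a j)) : f = g := by
  refine T.basis.ext fun ⟨a, j, hj⟩ => ?_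
  rw [← T.vec_eq_basis hj]
  exact h a j hj

variable {F : X →ₗ[ℝ] Module.End ℝ X} {x₀ : X}

/-- The values of a degree-one element of the Tanaka prolongation on a row have no component along
this row and no components along the `sl₂` containing the symbol. -/
lemma row_values (h3 : ∀ a : D.Row, a.IsIntegral → 4 ≤ a.boxes)
    (h4 : ∀ a : D.Row, ¬ a.IsIntegral → 6 ≤ a.boxes)
    (hF : ∀ v w, F v w - F w v = G.form v w • x₀) {c : X → ℕ → ℝ}
    (hc : ∀ v, T.HasCoefficients (F v) (c v)) (a : D.Row) (i : ℕ) (hi : i < a.boxes) :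
    (∀ m, c (T.vec a i) m = 0) ∧
      ∀ j k, j < a.boxes → k < a.boxes → T.rowCoord a k (F (T.vec a i) (T.vec a j)) = 0 := by
  have ha : 4 ≤ a.boxes := by
    by_cases h : a.IsIntegral
    · exact h3 a h
    · have := h4 a h; omega
  choose μ hμ using fun i => (hc (T.vec a i)).2.2 a
  obtain ⟨e0, e1, e2, e3⟩ := row_coefficients_eq_zero ha (h4 a) (fun i => c (T.vec a i) 0)
    (fun i => c (T.vec a i) 1) (fun i => c (T.vec a i) 2) μ _ (fun _ _ _ => rfl)
    (fun i j k hi hj hk hij => by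
      rw [← hμ i j k hj hk, ← hμ j i k hi hk, ← sub_eq_zero, ← map_sub, hF,
        T.form_vec_vec hi hj hij, zero_smul, map_zero]) i hi
  refine ⟨fun m => ?_, fun j k hj hk => ?_⟩
  · match m with
    | 0 => exact e0
    | 1 => exact e1
    | 2 => exact e2
    | m + 3 => exact (hc _).2.1 _ (by omega)
  · rw [hμ i j k hj hk]
    simp [e0, e1, e2, e3]

/-- For a degree-one element `F` of the Tanaka prolongation, the vector `F|_{η^{-2}}` is
orthogonal to all rows. -/
lemma form_vec_eq_zero (h1 : D.NoSeparatedRows)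
    (hb : ∀ a : D.Row, 4 ≤ a.boxes)
    (hF : ∀ v w, F v w - F w v = G.form v w • x₀)
    (hconf : ∀ v x y, G.form (F v x) y + G.form x (F v y) = G.form x y * G.form x₀ v)
    {c : X → ℕ → ℝ} (hc : ∀ v, T.HasCoefficients (F v) (c v)) (a : D.Row)
    (hrow : ∀ i j k, i < a.boxes → j < a.boxes → k < a.boxes →
      T.rowCoord a k (F (T.vec a i) (T.vec a j)) = 0) (m : ℕ) :
    G.form x₀ (T.vec a m) = 0 := by
  set w := T.basis (Box.dual ⟨a, ⟨0, a.boxes_pos⟩⟩) with hw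
  set κ := T.dualCoeff ⟨a, ⟨0, a.boxes_pos⟩⟩ with hκ
  have hκ0 : κ ≠ 0 := T.dualCoeff_ne_zero _
  have hform : ∀ y, G.form y w = κ * T.rowCoord a 0 y := by
    intro y
    rw [hw, form_dual, rowCoord, dif_pos a.boxes_pos]
  have hrow' : ∀ i j, T.rowCoord a 0 (F (T.vec a i) (T.vec a j)) = 0 := by
    intro i j
    by_cases hi : i < a.boxes
    · by_cases hj : j < a.boxes
      · exact hrow i j 0 hi hj a.boxes_pos
      · rw [T.vec_eq_zero (not_lt.1 hj), map_zero, map_zero]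
    · rw [T.vec_eq_zero (not_lt.1 hi), map_zero, LinearMap.zero_apply, map_zero]
  have hvw : ∀ i, G.form (T.vec a i) w = if i = 0 then κ else 0 := by
    intro i
    rw [hform, T.rowCoord_vec a.boxes_pos]
    simp [eq_comm]
  -- Exchange w and v_j by `hF`, then move F(v_j) across the form by `hconf`; what remains of F is a
  -- coordinate along the row, zero by `hrow'`.
  have hterm : ∀ i j, G.form (T.vec a i) (F w (T.vec a j)) =
      (if i = 0 then κ * G.form x₀ (T.vec a j) else 0) +
      (if j = 0 then κ * G.form x₀ (T.vec a i) else 0) := by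
    intro i j
    have e1 : F w (T.vec a j) = F (T.vec a j) w - G.form (T.vec a j) w • x₀ := by
      rw [← hF]; abel
    have e2 := hconf (T.vec a j) (T.vec a i) w
    rw [hform (F (T.vec a j) (T.vec a i)), hrow', mul_zero, zero_add] at e2
    rw [e1, map_sub, e2, map_smul, hvw, hvw, smul_eq_mul, G.form_swap (T.vec a i) x₀]
    split_ifs <;> ring
  -- Up to a multiple of N the operator preserves the filtration and v₀ has positive weight, so the
  -- form vanishes; N contributes σ(v₀, v₁) = 0.
  have hzero : G.form (T.vec a 0) ((T.ad ^ m) (F w) (T.vec a 0)) = 0 := by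
    have hmem := (hc w).1 m (a.left) (T.vec a 0)
      (G.grading_le_filtration le_rfl (by simpa using T.vec_mem a 0))
    have := G.form_eq_zero_of_mem_filtration (i := a.left)
      (by have := h1.left_pos a; omega) (by simpa using T.vec_mem a 0) hmem
    rw [LinearMap.sub_apply, LinearMap.smul_apply, gen_vec, map_sub, map_smul,
      T.form_vec_vec a.boxes_pos (by have := hb a; omega) (fun _ => by have := hb a; omega),
      smul_zero, sub_zero] at this
    exact this
  rw [ad_pow_apply, LinearMap.sum_apply, map_sum] at hzero
  -- The binomial sign (-1)^i cancels the sign from moving N^i across the form. Only i = 0 and i = m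
  -- survive, with equal contributions, so nothing cancels; for m = 0 both fall on the same term.
  have hsum : ∀ i ∈ Finset.range (m + 1), G.form (T.vec a 0)
      ((((m.choose i : ℝ) * (-1) ^ i) • (T.gen ^ i * F w * T.gen ^ (m - i))) (T.vec a 0)) =
      (if i = 0 then κ * G.form x₀ (T.vec a m) else 0) +
      (if i = m then κ * G.form x₀ (T.vec a m) else 0) := by
    intro i hi
    rw [Finset.mem_range] at hi
    have hs := T.form_gen_pow i (T.vec a 0) (F w (T.vec a (m - i)))
    rw [gen_pow_vec, add_zero] at hs
    have hsq : ((-1 : ℝ) ^ i) * (-1) ^ i = 1 := by rw [← mul_pow]; simp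
    have hs' : G.form (T.vec a 0) ((T.gen ^ i) (F w (T.vec a (m - i)))) =
        (-1) ^ i * G.form (T.vec a i) (F w (T.vec a (m - i))) := by
      rw [hs, ← mul_assoc, hsq, one_mul]
    rw [LinearMap.smul_apply, map_smul, smul_eq_mul, Module.End.mul_apply, Module.End.mul_apply,
      gen_pow_vec, add_zero, hs', hterm, mul_assoc, ← mul_assoc ((-1) ^ i), hsq, one_mul, mul_add]
    congr 1
    · split_ifs with h
      · subst h; simp
      · simp
    · by_cases h : i = m
      · subst h; simp
      · rw [if_neg h, if_neg (by omega), mul_zero]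
  rw [Finset.sum_congr rfl hsum, Finset.sum_add_distrib, Finset.sum_ite_eq', Finset.sum_ite_eq',
    if_pos (by simp), if_pos (by simp)] at hzero
  have : κ * G.form x₀ (T.vec a m) = 0 := by linarith
  exact (mul_eq_zero.1 this).resolve_left hκ0

/-- The first Tanaka prolongation: its elements vanish on `η^{-2}` and take values in the algebra of
infinitesimal symmetries of the flat curve. -/
theorem first_prolongation [FiniteDimensional ℝ X] (T : SkewYoungTableau δ D)
    (h1 : D.NoSeparatedRows)
    (h3 : ∀ a : D.Row, a.IsIntegral → 4 ≤ a.boxes)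
    (h4 : ∀ a : D.Row, ¬ a.IsIntegral → 6 ≤ a.boxes)
    (hu : ∀ v, F v ∈ δ.uF) (hF : ∀ v w, F v w - F w v = G.form v w • x₀)
    (hconf : ∀ v x y, G.form (F v x) y + G.form x (F v y) = G.form x y * G.form x₀ v) :
    x₀ = 0 ∧ ∀ v, F v ∈ δ.lX := by
  have hb : ∀ a : D.Row, 4 ≤ a.boxes := by
    intro a
    by_cases h : a.IsIntegral
    · exact h3 a h
    · have := h4 a h; omega
  choose c hc using fun v => T.exists_hasCoefficients (fun a => by have := hb a; omega) (hu v)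
  have hrow := T.row_values h3 h4 hF hc
  have hx₀ : x₀ = 0 := by
    refine G.nondegenerate.1 x₀ fun y => ?_
    have : G.form x₀ = 0 := T.ext_vec fun a j _ =>
      T.form_vec_eq_zero h1 hb hF hconf hc a (fun i j k hi hj hk => (hrow a i hi).2 j k hj hk) j
    rw [this, LinearMap.zero_apply]
  refine ⟨hx₀, fun v => ?_⟩
  subst hx₀
  have hmem : Submodule.span ℝ (Set.range T.basis) ≤ δ.lX.toSubmodule.comap F := by
    rw [Submodule.span_le]
    rintro _ ⟨⟨a, j, hj⟩, rfl⟩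
    refine T.mem_lX_iff.2 ⟨fun x y => ?_, fun m => ?_⟩
    · have := hconf (T.basis ⟨a, j, hj⟩) x y
      rw [map_zero, LinearMap.zero_apply, mul_zero] at this
      exact eq_neg_of_add_eq_zero_left this
    · rw [← T.vec_eq_basis hj]
      have := (hc (T.vec a j)).1 m
      rwa [(hrow a j hj).1 m, zero_smul, sub_zero] at this
  exact hmem (T.basis.mem_span v)

end SkewYoungTableau

/-! ### Translation of the degree-one Tanaka data into F and x₀. -/

theorem mainTheorem4 {X : Type*} [AddCommGroup X] [Module ℝ X] [FiniteDimensional ℝ X]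
    (G : GradedSympSpace X) (δ : SympFlagSymbol G)
    (D : SkewYoungDiagram) (T : SkewYoungTableau δ D)
    (h1 : D.NoSeparatedRows)
    (h2 : ¬ D.IsSingleRowOfTwo)
    (h3 : ∀ a : D.Row, a.IsIntegral → 4 ≤ a.boxes)
    (h4 : ∀ a : D.Row, ¬ a.IsIntegral → 6 ≤ a.boxes)
    (i : ℕ) (hi : 0 < i) :
    Set.InjOn (HeisAmbient.restrict (i + 1))
        (tanakaProlong G.form δ.uF i : Set (HeisAmbient X (i + 2))) ∧
      (tanakaProlong G.form δ.uF i).map (HeisAmbient.restrict (i + 1)) =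
        stdProlong δ.lX.toSubmodule i := by
  obtain ⟨n, rfl⟩ : ∃ n, i = n + 1 := ⟨i - 1, by omega⟩
  refine HeisAmbient.tanaka_eq_stdProlong T.exists_form_ne_zero T.lX_le_uF
    (fun A hA v w => ?_) (fun f hf => ?_) n
  · rw [(T.mem_lX_iff.1 hA).1, G.form_swap v, neg_neg]
  obtain ⟨hX, -, hL⟩ := HeisAmbient.mem_tanaka_add_three.1 hf
  let F : X →ₗ[ℝ] Module.End ℝ X := HeisAmbient.onX 0 ∘ₗ HeisAmbient.onX 1 f
  let x₀ : X := (show ℝ →ₗ[ℝ] X from HeisAmbient.onZ 1 f) 1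
  have hx₀ : ∀ t : ℝ, (show ℝ →ₗ[ℝ] X from HeisAmbient.onZ 1 f) t = t • x₀ := by
    intro t
    rw [← map_smul, smul_eq_mul, mul_one]
  have hF : ∀ v w, F v w - F w v = G.form v w • x₀ := fun v w => by
    rw [← hx₀]
    exact (hL.1 v w).symm
  -- The Leibniz rule on η^{-1} × η^{-2} identifies the action of F(v) on η^{-2}, and so its
  -- conformal factor, with σ(x₀, v).
  have hz : ∀ (v : X) (t : ℝ), (show ULift ℝ from
      HeisAmbient.onZ 0 (HeisAmbient.onX 1 f v) t).down = t * G.form x₀ v := by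
    intro v t
    have h : (show ULift ℝ from HeisAmbient.onZ 0 (HeisAmbient.onX 1 f v) t).down =
        G.form ((show ℝ →ₗ[ℝ] X from HeisAmbient.onZ 1 f) t) v :=
      congrArg ULift.down (hL.2.1 v t)
    rw [h, hx₀, map_smul, LinearMap.smul_apply, smul_eq_mul]
  have hconf : ∀ v x y, G.form (F v x) y + G.form x (F v y) = G.form x y * G.form x₀ v := by
    intro v x y
    have h := HeisAmbient.onZ_form_down (hX v).2 x y
    rw [hz] at h
    rw [h, G.form_swap x (F v y)]
    rfl
  obtain ⟨h0, hl⟩ := T.first_prolongation h1 h3 h4 (fun v => (hX v).1) hF hconf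
  refine ⟨LinearMap.ext fun t => ?_, hl⟩
  exact (hx₀ t).trans (by rw [h0, smul_zero]; rfl)
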